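/- Let $G$ be an additively written finite abelian group. A sequence over $G$ is a finite unordered sequence of elements of $G$, repetition allowed; a product of sequences denotes their concatenation, and $\operatorname{supp}(S)$ is the set of terms of $S$. A minimal zero-sum sequence is a non-empty sequence with sum $0$ none of whose proper non-empty subsequences has sum $0$. Let $\mathsf D(G)$ be the maximal length of a minimal zero-sum sequence over $G$, let $\exp(G)$ be the exponent of $G$, and for a prime $p$ let $\mathsf r_p(G)=\dim_{\mathbb F_p}\{g\in G: pg=0\}$. For $G_0\subset G$ let $\Delta(G_0)$ be the set of all differences $b-a$ of consecutive elements $a<b$ of sets $\mathsf L(A)$, where $A$ runs over the zero-sum sequences over $G_0$ and $\mathsf L(A)$ is the set of all $k\ge 0$ such that $A$ is a product of $k$ minimal zero-sum sequences over $G_0$. Theorem 1.2. Let $G$ be a non-cyclic finite abelian group that satisfies one of the following conditions. (a) $G$ is a $p$-group for some prime $p$, and $\gcd(\exp(G)-2,\mathsf D(G)-2)=1$. (b) $G\cong C_{p^{s_1}}^{r_1}\oplus C_{p^{s_2}}^{r_2}$, where $p$ is a prime and $r_1,r_2,s_1,s_2$ are positive integers such that $s_1\mid s_2$, and $G$ is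 not an elementary $2$-group. (c) $\exp(G)=pq$, where $p,q$ are distinct primes satisfying one of the following properties: (i) $\gcd(pq-2,\mathsf D(G)-2)=1$; (ii) $\gcd(pq-2,p+q-3)=1$; (iii) $q=2$ and $p-1$ is a power of $2$; (iv) $q=2$ and $\mathsf r_p(G)=1$. (d) $\exp(G)\in[3,11]\setminus\{8\}$. Then for every minimal zero-sum sequence $U=g_1\cdots g_\ell$ over $G$ of length $\ell=\mathsf D(G)$ there are a positive integer $k$ and minimal zero-sum sequences $U_1,\dots,U_k,V_1,\dots,V_{k+1}$ with terms from $\{g_1,\dots,g_\ell,-g_1,\dots,-g_\ell\}$ such that $U_1\cdots U_k=V_1\cdots V_{k+1}$; equivalently, $\min\Delta(\operatorname{supp}((-U)U))=1$. -/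

import Mathlib

namespace ZeroSum

section

variable {G : Type*} [AddCommGroup G]

/-- A sequence over `G` (finite, unordered, repetition allowed) is a `Multiset G`; concatenation
is addition of multisets. It is a minimal zero-sum sequence if it is non-empty, has sum zero, and
no proper non-empty subsequence has sum zero. -/
def IsMinZeroSum (U : Multiset G) : Prop :=
  U ≠ 0 ∧ U.sum = 0 ∧ ∀ T ≤ U, T ≠ 0 → T.sum = 0 → T = U

/-- `U` is a minimal zero-sum sequence all of whose terms lie in `G₀`, i.e. an atom of the monoid
of zero-sum sequences over `G₀`. -/
def IsMinZeroSumOver (G₀ : Set G) (U : Multiset G) : Prop :=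
  IsMinZeroSum U ∧ ∀ g ∈ U, g ∈ G₀

/-- The Davenport constant: the maximal length of a minimal zero-sum sequence over `G`
(for finite `G` the lengths are bounded by `|G|`, so the supremum is a maximum). -/
noncomputable def davenport (G : Type*) [AddCommGroup G] : ℕ :=
  sSup {n | ∃ U : Multiset G, IsMinZeroSum U ∧ U.card = n}

/-- `supp((-U)U) = {g₁, …, g_ℓ, -g₁, …, -g_ℓ}` for `U = g₁ ⋯ g_ℓ`. -/
def symmSupp (U : Multiset G) : Set G := {g | g ∈ U ∨ -g ∈ U}

/-- There are `k ≥ 1` and minimal zero-sum sequences `U₁, …, U_k, V₁, …, V_{k+1}` over `G₀` with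
`U₁ ⋯ U_k = V₁ ⋯ V_{k+1}`. -/
def HasUnitStep (G₀ : Set G) : Prop :=
  ∃ k : ℕ, 1 ≤ k ∧ ∃ (U : Fin k → Multiset G) (V : Fin (k + 1) → Multiset G),
    (∀ i, IsMinZeroSumOver G₀ (U i)) ∧ (∀ j, IsMinZeroSumOver G₀ (V j)) ∧
      ∑ i, U i = ∑ j, V j

/-- The set of lengths of `A` in the monoid of zero-sum sequences over `G₀`. -/
def setOfLengths (G₀ : Set G) (A : Multiset G) : Set ℕ :=
  {k | ∃ W : Fin k → Multiset G, (∀ i, IsMinZeroSumOver G₀ (W i)) ∧ ∑ i, W i = A}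

/-- The set of distances between consecutive elements of `L`. -/
def distances (L : Set ℕ) : Set ℕ :=
  {d | ∃ a ∈ L, ∃ b ∈ L, a < b ∧ (∀ c ∈ L, ¬ (a < c ∧ c < b)) ∧ d = b - a}

/-- `Δ(G₀)`: the union of the sets of distances of the sets of lengths of all zero-sum sequences
over `G₀`. -/
def setOfDistances (G₀ : Set G) : Set ℕ :=
  {d | ∃ A : Multiset G, A.sum = 0 ∧ (∀ g ∈ A, g ∈ G₀) ∧ d ∈ distances (setOfLengths G₀ A)}

end

/-- The `p`-rank of `G` (`p` prime): the dimension over `ℤ/p` of `{g : G | p • g = 0}`. -/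
noncomputable def pRank (p : ℕ) (G : Type*) [AddCommGroup G] : ℕ :=
  letI : Module (ZMod p) (AddSubgroup.torsionBy G (p : ℤ)) := AddSubgroup.torsionBy.zmodModule
  Module.finrank (ZMod p) (AddSubgroup.torsionBy G (p : ℤ))

/-- `G` is a `p`-group with `gcd(exp(G) - 2, D(G) - 2) = 1`. (For non-cyclic `G` one has
`exp(G) ≥ 2` and `D(G) ≥ 3`, so the subtractions do not truncate.) -/
def FamilyA (G : Type*) [AddCommGroup G] : Prop :=
  ∃ p : ℕ, p.Prime ∧ IsPGroup p (Multiplicative G) ∧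
    Nat.gcd (AddMonoid.exponent G - 2) (davenport G - 2) = 1

/-- `G ≅ C_{p^{s₁}}^{r₁} ⊕ C_{p^{s₂}}^{r₂}` with `p` prime, `r₁, r₂, s₁, s₂ ≥ 1` and `s₁ ∣ s₂`, where
`G` is not an elementary `2`-group. -/
def FamilyB (G : Type*) [AddCommGroup G] : Prop :=
  ∃ p r₁ r₂ s₁ s₂ : ℕ, p.Prime ∧ 1 ≤ r₁ ∧ 1 ≤ r₂ ∧ 1 ≤ s₁ ∧ 1 ≤ s₂ ∧ s₁ ∣ s₂ ∧
    Nonempty (G ≃+ (Fin r₁ → ZMod (p ^ s₁)) × (Fin r₂ → ZMod (p ^ s₂))) ∧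
    AddMonoid.exponent G ≠ 2

/-- `exp(G) = pq` with distinct primes `p, q` that satisfy one of four conditions. (Here
`pq ≥ 6`, `p + q ≥ 5`, and `D(G) ≥ 3`, so the subtractions do not truncate.) -/
def FamilyC (G : Type*) [AddCommGroup G] : Prop :=
  ∃ p q : ℕ, p.Prime ∧ q.Prime ∧ p ≠ q ∧ AddMonoid.exponent G = p * q ∧
    (Nat.gcd (p * q - 2) (davenport G - 2) = 1 ∨
      Nat.gcd (p * q - 2) (p + q - 3) = 1 ∨
      (q = 2 ∧ ∃ m : ℕ, p - 1 = 2 ^ m) ∨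
      (q = 2 ∧ pRank p G = 1))

/-- `exp(G) ∈ [3, 11] \ {8}`. -/
def FamilyD (G : Type*) [AddCommGroup G] : Prop :=
  AddMonoid.exponent G ∈ Set.Icc 3 11 \ {8}

end ZeroSum

/-! Let G₀ be the support of (-U)U. The differences of factorization lengths over G₀ form a subgroup
dℤ of ℤ; if d ≠ ±1, some prime ℓ divides every difference, which is `LengthCongr G₀ ℓ`. The proof
refutes this congruence for every prime ℓ; then 1 is a difference, which gives both conclusions.

Writing (-A)A as a product of |A| pairs x(-x) shows that every atom A has length ≡ 2 mod ℓ, so D(G)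
and the orders of all terms are ≡ 2. Moreover, if an atom contains v copies of g, and exchanging
them for ord(g) - v copies of -g gives another atom, then v ≡ 1 (`LengthCongr.flip`).

Take independent terms e_i of U and another term g, of order m modulo their span, say m g = ∑ a_i
e_i with 0 ≤ a_i < ord(e_i). This relation is an atom, and so are its flips. Hence a_i ≡ 1 whenever
a_i ≠ 0, and m + |supp a| ≡ 2. The doubled relation shows in addition that 2mg = 0 or |supp a| ≤ 1
(`LengthCongr.two_mul_smul_eq_zero_or`).

Unless a gcd condition on D(G) is already violated, the arithmetic of the exponent now forces each
term of U to be killed by 2 or to lie in some ⟨e_i⟩, for suitable independent terms e_i. That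
contradicts the maximal length of U (`IsMinZeroSum.false_of_splitting`): the terms in one ⟨b⟩ would
form a zero-sum free sequence of maximal length there, whose sum generates ⟨b⟩, while twice this sum
is 0. For ℓ = 2 and exponent 2p the congruences are too weak, and the terms e_i are taken
independent only after doubling (`OddIndepOn`). -/

namespace ZeroSum

/-! ### Zero-sum free sequences and atoms of maximal length. -/

section Basic

variable {G : Type*} [AddCommGroup G]

/-- A sequence is zero-sum free if its only subsequence of sum zero is the empty one. -/
def IsZeroSumFree (S : Multiset G) : Prop := ∀ T ≤ S, T.sum = 0 → T = 0

theorem IsZeroSumFree.mono {S T : Multiset G} (hS : IsZeroSumFree S) (h : T ≤ S) :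
    IsZeroSumFree T := fun R hR => hS R (hR.trans h)

theorem sum_sub_of_le [DecidableEq G] {S T : Multiset G} (h : T ≤ S) : (S - T).sum = S.sum - T.sum := by
  have := congrArg Multiset.sum (tsub_add_cancel_of_le h)
  rw [Multiset.sum_add] at this
  exact eq_sub_of_add_eq this

theorem IsZeroSumFree.isMinZeroSum_cons {S : Multiset G} (hS : IsZeroSumFree S) :
    IsMinZeroSum ((-S.sum) ::ₘ S) := by
  classical
  refine ⟨Multiset.cons_ne_zero, by simp, fun T hT hT0 hsum => ?_⟩
  by_cases hx : -S.sum ∈ T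
  · obtain ⟨T', rfl⟩ := Multiset.exists_cons_of_mem hx
    have hle : T' ≤ S := (Multiset.cons_le_cons_iff _).1 hT
    have h1 : (S - T').sum = 0 := by
      rw [sum_sub_of_le hle]
      rw [Multiset.sum_cons] at hsum
      rw [← neg_eq_zero, ← hsum]
      abel
    have h2 := hS _ (Multiset.sub_le_self _ _) h1
    rw [le_antisymm hle (tsub_eq_zero_iff_le.1 h2)]
  · exact absurd (hS T ((Multiset.le_cons_of_notMem hx).1 hT) hsum) hT0

theorem IsMinZeroSum.isZeroSumFree {U S : Multiset G} (hU : IsMinZeroSum U) (h : S < U) :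
    IsZeroSumFree S := fun T hT hs => by
  by_contra hT0
  exact (hT.trans_lt h).ne (hU.2.2 T (hT.trans h.le) hT0 hs)

theorem isMinZeroSum_pair {x : G} (hx : x ≠ 0) : IsMinZeroSum {x, -x} := by
  have h : IsZeroSumFree ({-x} : Multiset G) := fun T hT hs => by
    rcases Multiset.le_singleton.1 hT with rfl | rfl
    · rfl
    · simp [hx] at hs
  simpa using h.isMinZeroSum_cons

open Classical in
/-- The set of sums of non-empty subsequences. -/
noncomputable def subsums (S : Multiset G) : Finset G :=
  ((S.powerset.filter (· ≠ 0)).map Multiset.sum).toFinset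

theorem mem_subsums {S : Multiset G} {g : G} :
    g ∈ subsums S ↔ ∃ T ≤ S, T ≠ 0 ∧ T.sum = g := by
  simp [subsums, and_assoc]

theorem subsums_mono {S T : Multiset G} (h : T ≤ S) : subsums T ⊆ subsums S := fun g hg => by
  obtain ⟨R, hR, h0, hs⟩ := mem_subsums.1 hg
  exact mem_subsums.2 ⟨R, hR.trans h, h0, hs⟩

/-- Each added term creates a new subsum, namely the total: if a shorter subsequence had the same
sum, its non-empty complement would have sum zero. -/
theorem IsZeroSumFree.card_subsums_add {T R : Multiset G} (h : IsZeroSumFree (T + R)) :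
    (subsums T).card + R.card ≤ (subsums (T + R)).card := by
  classical
  induction R using Multiset.induction with
  | empty => simp
  | cons a R ih =>
    have hle : T + R ≤ T + a ::ₘ R := by
      gcongr
      exact Multiset.le_cons_self _ _
    have ih' := ih (h.mono hle)
    have hlt : subsums (T + R) ⊂ subsums (T + a ::ₘ R) := by
      refine Finset.ssubset_iff_of_subset (subsums_mono hle) |>.2
        ⟨(T + a ::ₘ R).sum, mem_subsums.2 ⟨_, le_rfl, by simp, rfl⟩, fun hm => ?_⟩
      obtain ⟨P, hP, hP0, hs⟩ := mem_subsums.1 hm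
      have h1 := h _ (Multiset.sub_le_self _ P) (by rw [sum_sub_of_le (hP.trans hle), hs, sub_self])
      have h2 := Multiset.card_le_card ((tsub_eq_zero_iff_le.1 h1).trans hP)
      simp at h2
    have := Finset.card_lt_card hlt
    rw [Multiset.card_cons]
    omega

theorem IsZeroSumFree.card_le {S : Multiset G} (h : IsZeroSumFree S) :
    S.card ≤ (subsums S).card := by
  have := IsZeroSumFree.card_subsums_add (T := 0) (R := S) (by simpa using h)
  rw [zero_add] at this
  omega

theorem IsMinZeroSum.card_le_davenport [Finite G] {U : Multiset G} (hU : IsMinZeroSum U) :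
    U.card ≤ davenport G := by
  have := Fintype.ofFinite G
  refine le_csSup ⟨Fintype.card G + 1, ?_⟩ ⟨U, hU, rfl⟩
  rintro _ ⟨V, hV, rfl⟩
  obtain ⟨g, hg⟩ := Multiset.exists_mem_of_ne_zero hV.1
  obtain ⟨V', rfl⟩ := Multiset.exists_cons_of_mem hg
  have h1 := (hV.isZeroSumFree (Multiset.lt_cons_self V' g)).card_le
  have h2 := Finset.card_le_univ (subsums V')
  rw [Multiset.card_cons]
  omega

theorem IsZeroSumFree.card_lt_davenport [Finite G] {S : Multiset G} (hS : IsZeroSumFree S) :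
    S.card < davenport G := by
  have := hS.isMinZeroSum_cons.card_le_davenport
  rw [Multiset.card_cons] at this
  omega

theorem two_le_davenport [Finite G] [Nontrivial G] : 2 ≤ davenport G := by
  obtain ⟨x, hx⟩ := exists_ne (0 : G)
  simpa using (isMinZeroSum_pair hx).card_le_davenport

theorem IsMinZeroSum.zero_notMem [Finite G] [Nontrivial G] {U : Multiset G} (hU : IsMinZeroSum U)
    (hc : U.card = davenport G) : (0 : G) ∉ U := fun h => by
  have h1 := hU.2.2 {0} (Multiset.singleton_le.2 h) (by simp) (by simp)
  have h2 := two_le_davenport (G := G)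
  rw [← hc, ← h1] at h2
  simp at h2

theorem sum_mem_closure {U T : Multiset G} (h : T ≤ U) :
    T.sum ∈ AddSubgroup.closure {g | g ∈ U} :=
  AddSubgroup.multiset_sum_mem _ _ fun _ hg =>
    AddSubgroup.subset_closure (Multiset.mem_of_le h hg)

/-- Replacing one term by an element outside the span would keep the sequence zero-sum free, and its
length D(G) is too large for that. -/
theorem IsMinZeroSum.closure_eq_top [Finite G] {U : Multiset G} (hU : IsMinZeroSum U)
    (hc : U.card = davenport G) : AddSubgroup.closure {g | g ∈ U} = ⊤ := by
  by_contra hne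
  obtain ⟨h, hh⟩ : ∃ h, h ∉ AddSubgroup.closure {g | g ∈ U} := by
    by_contra! hall
    exact hne ((AddSubgroup.eq_top_iff' _).2 hall)
  obtain ⟨g, hg⟩ := Multiset.exists_mem_of_ne_zero hU.1
  obtain ⟨V, rfl⟩ := Multiset.exists_cons_of_mem hg
  have hlt := Multiset.lt_cons_self V g
  have hfree : IsZeroSumFree (h ::ₘ V) := fun T hT hs => by
    by_cases hx : h ∈ T
    · obtain ⟨T', rfl⟩ := Multiset.exists_cons_of_mem hx
      have hle : T' ≤ V := (Multiset.cons_le_cons_iff _).1 hT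
      rw [Multiset.sum_cons] at hs
      refine absurd ?_ hh
      rw [eq_neg_of_add_eq_zero_left hs]
      exact neg_mem (sum_mem_closure (hle.trans hlt.le))
    · exact hU.isZeroSumFree hlt T ((Multiset.le_cons_of_notMem hx).1 hT) hs
  have := hfree.card_lt_davenport
  rw [← hc] at this
  simp at this

/-- A zero-sum free sequence of maximal length over a finite cyclic group is constant; in
particular its sum generates the group. -/
theorem IsZeroSumFree.two_nsmul_sum_ne_zero {b : G} {S : Multiset G} (hb : 2 < addOrderOf b)
    (hS : IsZeroSumFree S) (hmem : ∀ g ∈ S, g ∈ AddSubgroup.zmultiples b)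
    (hcard : addOrderOf b ≤ S.card + 1) : 2 • S.sum ≠ 0 := by
  classical
  intro h2
  have hfin : Finite (AddSubgroup.zmultiples b) :=
    Nat.finite_of_card_ne_zero (by rw [Nat.card_zmultiples]; omega)
  have hset : (AddSubgroup.zmultiples b : Set G).Finite := hfin
  -- The subsums lie in ⟨b⟩ and avoid 0.
  have hsub : (subsums S).card + 1 ≤ addOrderOf b := by
    have hss : insert 0 (subsums S) ⊆ hset.toFinset := fun x hx => by
      rw [Set.Finite.mem_toFinset]
      rcases Finset.mem_insert.1 hx with rfl | hx
      · exact zero_mem _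
      obtain ⟨T, hT, -, rfl⟩ := mem_subsums.1 hx
      exact AddSubgroup.multiset_sum_mem _ _ fun g hg => hmem g (Multiset.mem_of_le hT hg)
    have h0 : (0 : G) ∉ subsums S := fun h => by
      obtain ⟨T, hT, hT0, hs⟩ := mem_subsums.1 h
      exact hT0 (hS T hT hs)
    have := Finset.card_le_card hss
    rw [Finset.card_insert_of_notMem h0, ← Set.ncard_eq_toFinset_card _ hset] at this
    rwa [← Nat.card_zmultiples]
  have hcs := hS.card_le
  obtain ⟨a, ha⟩ := Multiset.card_pos_iff_exists_mem.1 (show 0 < S.card by omega)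
  have hconst : ∀ c ∈ S, c = a := by
    intro c hc
    by_contra hne
    have hle : ({c, a} : Multiset G) ≤ S := by
      refine (Multiset.le_iff_subset ?_).2 ?_
      · simpa using hne
      · intro x hx
        simp only [Multiset.insert_eq_cons, Multiset.mem_cons, Multiset.mem_singleton] at hx
        rcases hx with rfl | rfl <;> assumption
    have hfree := hS.mono hle
    have hc0 : c ≠ 0 := fun h => by
      have := hS {c} (Multiset.singleton_le.2 hc) (by simpa using h)
      simp at this
    have ha0 : a ≠ 0 := fun h => by
      have := hS {a} (Multiset.singleton_le.2 ha) (by simpa using h)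
      simp at this
    -- Two distinct terms already have three subsums, one more than the general bound; this surplus
    -- survives and exceeds the room in ⟨b⟩.
    have h3 : 3 ≤ (subsums ({c, a} : Multiset G)).card := by
      have hss : ({c, a, c + a} : Finset G) ⊆ subsums ({c, a} : Multiset G) := by
        intro x hx
        simp only [Finset.mem_insert, Finset.mem_singleton] at hx
        rcases hx with rfl | rfl | rfl
        · exact mem_subsums.2 ⟨{x}, by simp, by simp, by simp⟩
        · exact mem_subsums.2 ⟨{x}, by simp, by simp, by simp⟩
        · exact mem_subsums.2 ⟨{c, a}, le_rfl, by simp, by simp⟩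
      have hcd : ({c, a, c + a} : Finset G).card = 3 := by
        rw [Finset.card_eq_three]
        exact ⟨c, a, c + a, hne, by simpa using ha0, by simpa using hc0, rfl⟩
      exact hcd ▸ Finset.card_le_card hss
    obtain ⟨R, rfl⟩ := Multiset.le_iff_exists_add.1 hle
    have h4 := hS.card_subsums_add
    have h5 : ({c, a} + R).card = 2 + R.card := by rw [Multiset.card_add]; simp
    omega
  have hrep : S = Multiset.replicate S.card a := Multiset.eq_replicate_card.2 hconst
  have hord : addOrderOf a ≤ addOrderOf b := by
    obtain ⟨k, hk⟩ := AddSubgroup.mem_zmultiples_iff.1 (hmem a ha)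
    refine Nat.le_of_dvd (by omega) (addOrderOf_dvd_of_nsmul_eq_zero ?_)
    rw [← hk, smul_comm, addOrderOf_nsmul_eq_zero, smul_zero]
  have hpos : 0 < addOrderOf a := by
    have hba : IsOfFinAddOrder b := addOrderOf_pos_iff.1 (by omega)
    obtain ⟨k, hk⟩ := AddSubgroup.mem_zmultiples_iff.1 (hmem a ha)
    exact hk ▸ addOrderOf_pos_iff.2 hba.zsmul
  have hgt : S.card < addOrderOf a := by
    by_contra hle
    have := hS (Multiset.replicate (addOrderOf a) a)
      (by rw [hrep]; exact Multiset.replicate_le_replicate _ |>.2 (by simpa using hle))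
      (by rw [Multiset.sum_replicate, addOrderOf_nsmul_eq_zero])
    have := congrArg Multiset.card this
    rw [Multiset.card_replicate, Multiset.card_zero] at this
    omega
  -- The bounds |S| < ord(a) ≤ ord(b) ≤ |S| + 1 force ord(a) = |S| + 1.
  have hs : S.sum + a = 0 := by
    rw [hrep, Multiset.sum_replicate, ← succ_nsmul]
    rw [show S.card + 1 = addOrderOf a by omega, addOrderOf_nsmul_eq_zero]
  have h2a : 2 • a = 0 := by
    rw [eq_neg_of_add_eq_zero_left hs, smul_neg, neg_eq_zero] at h2
    exact h2
  have := Nat.le_of_dvd (by norm_num) (addOrderOf_dvd_of_nsmul_eq_zero h2a)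
  omega

/-- If a minimal zero-sum sequence of maximal length is `S * R` with `S` over a cyclic group `⟨b⟩`
and `R` minimal of sum zero modulo `⟨b⟩`, then `S` is as long as a zero-sum free sequence over `⟨b⟩`
can be. -/
theorem IsMinZeroSum.addOrderOf_le_card [Finite G] {S R : Multiset G} {b : G}
    (hc : (S + R).card = davenport G) (hR0 : R ≠ 0)
    (hR : ∀ T ≤ R, T.sum ∈ AddSubgroup.zmultiples b → T = 0 ∨ T = R) :
    addOrderOf b ≤ S.card + 1 := by
  classical
  obtain ⟨r, hr⟩ := Multiset.exists_mem_of_ne_zero hR0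
  obtain ⟨R', rfl⟩ := Multiset.exists_cons_of_mem hr
  have hb := addOrderOf_pos b
  -- Trade S for the longest zero-sum free power of b and drop one term of R. A zero-sum part meets
  -- R' in a proper part of R with sum in ⟨b⟩, hence not at all.
  have hfree : IsZeroSumFree (Multiset.replicate (addOrderOf b - 1) b + R') := fun T hT hs => by
    have h1 : T - R' ≤ Multiset.replicate (addOrderOf b - 1) b := by
      rwa [tsub_le_iff_right]
    obtain ⟨k, hk, hkT⟩ := Multiset.le_replicate_iff.1 h1
    have hsplit : T = (T - R') + (T ∩ R') := by
      ext x; simp [Multiset.count_inter]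
    have hsum : k • b + (T ∩ R').sum = 0 := by
      rw [← hs]
      conv_rhs => rw [hsplit]
      rw [Multiset.sum_add, hkT, Multiset.sum_replicate]
    have hle : T ∩ R' ≤ R' := Multiset.inter_le_right
    have h2 : T ∩ R' = 0 := by
      refine (hR (T ∩ R') (hle.trans (Multiset.le_cons_self _ _)) ?_).resolve_right fun h => ?_
      · rw [eq_neg_of_add_eq_zero_right hsum]
        exact neg_mem (nsmul_mem (AddSubgroup.mem_zmultiples b) k)
      · have := Multiset.card_le_card hle
        rw [h] at this
        simp at this
    rw [h2, Multiset.sum_zero, add_zero] at hsum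
    have hdvd := addOrderOf_dvd_of_nsmul_eq_zero hsum
    have hk0 : k = 0 := Nat.eq_zero_of_dvd_of_lt hdvd (by omega)
    rw [hsplit, h2, hkT, hk0]
    simp
  have := hfree.card_lt_davenport
  rw [← hc] at this
  simp only [Multiset.card_add, Multiset.card_replicate, Multiset.card_cons] at this
  omega

/-- The terms of a minimal zero-sum sequence of maximal length over a non-cyclic group cannot be
split, up to elements of order two, between a cyclic subgroup and a complement. -/
theorem IsMinZeroSum.false_of_splitting [Finite G] (hG : ¬ IsAddCyclic G) {U : Multiset G}
    (hU : IsMinZeroSum U) (hc : U.card = davenport G) {b : G} (hbU : b ∈ U)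
    (hb : 2 < addOrderOf b) (C : AddSubgroup G)
    (hC : ∀ x ∈ C, x ∈ AddSubgroup.zmultiples b → x = 0)
    (h : ∀ g ∈ U, g ∈ AddSubgroup.zmultiples b ∨ 2 • g ∈ C) : False := by
  classical
  set S := U.filter (· ∈ AddSubgroup.zmultiples b) with hSdef
  set R := U.filter (· ∉ AddSubgroup.zmultiples b) with hRdef
  have hSR : S + R = U := Multiset.filter_add_not _ _
  have hbS : b ∈ S := Multiset.mem_filter.2 ⟨hbU, AddSubgroup.mem_zmultiples b⟩
  have hS0 : S ≠ 0 := fun h => by simp [h] at hbS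
  have hR0 : R ≠ 0 := fun h0 => by
    refine hG ⟨b, fun x => ?_⟩
    have hx : x ∈ AddSubgroup.closure {g | g ∈ U} := hU.closure_eq_top hc ▸ AddSubgroup.mem_top x
    refine (AddSubgroup.closure_le (AddSubgroup.zmultiples b)).2 (fun g hg => ?_) hx
    by_contra hgb
    have : g ∈ R := Multiset.mem_filter.2 ⟨hg, hgb⟩
    simp [h0] at this
  have hRU : R < U := by
    refine lt_of_le_of_ne (Multiset.filter_le _ _) fun h => hS0 ?_
    rw [h] at hSR
    simpa using hSR
  have hSU : S < U := by
    refine lt_of_le_of_ne (Multiset.filter_le _ _) fun h => hR0 ?_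
    rw [h] at hSR
    simpa using hSR
  have hRfree := hU.isZeroSumFree hRU
  have hSmem : S.sum ∈ AddSubgroup.zmultiples b :=
    AddSubgroup.multiset_sum_mem _ _ fun g hg => (Multiset.mem_filter.1 hg).2
  have hsum : S.sum + R.sum = 0 := by rw [← Multiset.sum_add, hSR, hU.2.1]
  have hRmem : R.sum ∈ AddSubgroup.zmultiples b := by
    rw [eq_neg_of_add_eq_zero_right hsum]; exact neg_mem hSmem
  have htwo : ∀ T ≤ R, T.sum ∈ AddSubgroup.zmultiples b → 2 • T.sum = 0 := fun T hT hTb => by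
    refine hC _ ?_ (nsmul_mem hTb 2)
    rw [← Multiset.map_id' T, ← Multiset.sum_map_nsmul]
    refine AddSubgroup.multiset_sum_mem _ _ fun x hx => ?_
    obtain ⟨g, hg, rfl⟩ := Multiset.mem_map.1 hx
    obtain ⟨hgU, hgb⟩ := Multiset.mem_filter.1 (Multiset.mem_of_le hT hg)
    exact (h g hgU).resolve_left hgb
  -- A cyclic group has at most one involution. So any non-empty part of R with sum in ⟨b⟩ has the
  -- same sum as R, and is R since R is zero-sum free.
  have huniq : ∀ x ∈ AddSubgroup.zmultiples b, 2 • x = 0 → x ≠ 0 →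
      ∀ y ∈ AddSubgroup.zmultiples b, 2 • y = 0 → y ≠ 0 → x = y := by
    intro x hx hx2 hx0 y hy hy2 hy0
    obtain ⟨k, rfl⟩ := AddSubgroup.mem_zmultiples_iff.1 hx
    obtain ⟨l, rfl⟩ := AddSubgroup.mem_zmultiples_iff.1 hy
    have hk : (addOrderOf b : ℤ) ∣ 2 * k := by
      rw [addOrderOf_dvd_iff_zsmul_eq_zero, mul_smul]; exact_mod_cast hx2
    have hl : (addOrderOf b : ℤ) ∣ 2 * l := by
      rw [addOrderOf_dvd_iff_zsmul_eq_zero, mul_smul]; exact_mod_cast hy2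
    have hk' : ¬ (addOrderOf b : ℤ) ∣ k := by rwa [addOrderOf_dvd_iff_zsmul_eq_zero]
    have hl' : ¬ (addOrderOf b : ℤ) ∣ l := by rwa [addOrderOf_dvd_iff_zsmul_eq_zero]
    rw [← sub_eq_zero, ← sub_smul, ← addOrderOf_dvd_iff_zsmul_eq_zero]
    obtain ⟨s, hs⟩ := hk
    obtain ⟨t, ht⟩ := hl
    have hs1 : s % 2 = 1 := by
      by_contra hs2
      obtain ⟨s', rfl⟩ : (2 : ℤ) ∣ s := by omega
      exact hk' ⟨s', by linarith⟩
    have ht1 : t % 2 = 1 := by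
      by_contra ht2
      obtain ⟨t', rfl⟩ : (2 : ℤ) ∣ t := by omega
      exact hl' ⟨t', by linarith⟩
    obtain ⟨w, hw⟩ : (2 : ℤ) ∣ s - t := by omega
    refine ⟨w, mul_left_cancel₀ (two_ne_zero (α := ℤ)) ?_⟩
    linear_combination hs - ht + (addOrderOf b : ℤ) * hw
  have hRsum0 : R.sum ≠ 0 := fun h => hR0 (hRfree R le_rfl h)
  have hkey : ∀ T ≤ R, T.sum ∈ AddSubgroup.zmultiples b → T = 0 ∨ T = R := by
    intro T hT hTb
    by_cases hT0 : T = 0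
    · exact Or.inl hT0
    right
    have hTs : T.sum = R.sum := huniq _ hTb (htwo T hT hTb) (fun h => hT0 (hRfree T hT h)) _ hRmem
      (htwo R le_rfl hRmem) hRsum0
    have h0 := hRfree (R - T) (Multiset.sub_le_self _ _) (by rw [sum_sub_of_le hT, hTs, sub_self])
    exact le_antisymm hT (tsub_eq_zero_iff_le.1 h0)
  have hlen := IsMinZeroSum.addOrderOf_le_card (S := S) (by rw [hSR, hc]) hR0 hkey
  refine (hU.isZeroSumFree hSU).two_nsmul_sum_ne_zero hb
    (fun g hg => (Multiset.mem_filter.1 hg).2) hlen ?_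
  rw [eq_neg_of_add_eq_zero_left hsum, smul_neg, htwo R le_rfl hRmem, neg_zero]

end Basic

/-! ### Sequences over ±f encoded by integer vectors. -/

section SignedSequences

variable {G : Type*} [AddCommGroup G] {ι : Type*}

/-- `u` lies between `0` and `v` in every coordinate. -/
def Conformal (u v : ι → ℤ) : Prop :=
  ∀ i, (0 ≤ u i ∧ u i ≤ v i) ∨ (v i ≤ u i ∧ u i ≤ 0)

theorem Conformal.sub {u v : ι → ℤ} (h : Conformal u v) : Conformal (v - u) v := fun i => by
  have := h i
  simp only [Pi.sub_apply]
  omega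

variable [Fintype ι]

/-- The sequence in which `f i` occurs `v i` times, where `v i < 0` stands for `|v i|` copies
of `-f i`. -/
def signedSeq (f : ι → G) (v : ι → ℤ) : Multiset G :=
  ∑ i, (Multiset.replicate (v i).toNat (f i) + Multiset.replicate (-v i).toNat (-f i))

theorem sum_signedSeq (f : ι → G) (v : ι → ℤ) : (signedSeq f v).sum = ∑ i, v i • f i := by
  rw [signedSeq, Multiset.sum_sum]
  refine Finset.sum_congr rfl fun i _ => ?_
  rw [Multiset.sum_add, Multiset.sum_replicate, Multiset.sum_replicate, smul_neg, ← sub_eq_add_neg,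
    ← natCast_zsmul, ← natCast_zsmul, ← sub_smul]
  congr 1
  omega

theorem card_signedSeq (f : ι → G) (v : ι → ℤ) :
    (signedSeq f v).card = ∑ i, (v i).natAbs := by
  rw [signedSeq, Multiset.card_sum]
  refine Finset.sum_congr rfl fun i _ => ?_
  rw [Multiset.card_add, Multiset.card_replicate, Multiset.card_replicate]
  omega

theorem mem_of_mem_signedSeq {f : ι → G} {v : ι → ℤ} {G₀ : Set G} (hf : ∀ i, f i ∈ G₀)
    (hneg : ∀ x ∈ G₀, -x ∈ G₀) {g : G} (hg : g ∈ signedSeq f v) : g ∈ G₀ := by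
  obtain ⟨i, -, hi⟩ := Multiset.mem_sum.1 hg
  rcases Multiset.mem_add.1 hi with h | h
  · exact Multiset.eq_of_mem_replicate h ▸ hf i
  · exact Multiset.eq_of_mem_replicate h ▸ hneg _ (hf i)

theorem exists_le_of_le_sum {α κ : Type*} (s : Finset κ) (A : κ → Multiset α) (T : Multiset α)
    (hT : T ≤ ∑ i ∈ s, A i) :
    ∃ B : κ → Multiset α, (∀ i, B i ≤ A i) ∧ T = ∑ i ∈ s, B i := by
  classical
  induction s using Finset.induction_on generalizing T with
  | empty => exact ⟨fun _ => 0, fun _ => Multiset.zero_le _, by simpa using hT⟩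
  | insert a s ha ih =>
    rw [Finset.sum_insert ha] at hT
    obtain ⟨B, hB, hTB⟩ := ih (T - A a) (by rwa [tsub_le_iff_left])
    refine ⟨Function.update B a (T ∩ A a), fun i => ?_, ?_⟩
    · rcases eq_or_ne i a with rfl | hi
      · simpa using Multiset.inter_le_right
      · simpa [hi] using hB i
    · rw [Finset.sum_insert ha, Finset.sum_congr rfl fun i hi => Function.update_of_ne
        (fun h : i = a => ha (h ▸ hi)) _ _, ← hTB, Function.update_self]
      ext x
      simp [Multiset.count_inter]
      omega

theorem exists_conformal_of_le_signedSeq {f : ι → G} {v : ι → ℤ} {T : Multiset G}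
    (hT : T ≤ signedSeq f v) : ∃ u, Conformal u v ∧ T = signedSeq f u := by
  obtain ⟨B, hB, rfl⟩ := exists_le_of_le_sum _ _ _ hT
  have key : ∀ i, ∃ z : ℤ, ((0 ≤ z ∧ z ≤ v i) ∨ (v i ≤ z ∧ z ≤ 0)) ∧
      B i = Multiset.replicate z.toNat (f i) + Multiset.replicate (-z).toNat (-f i) := by
    intro i
    have h := hB i
    rcases le_total 0 (v i) with hv | hv
    · rw [show (-v i).toNat = 0 by omega, Multiset.replicate_zero, add_zero] at h
      obtain ⟨k, hk, hk'⟩ := Multiset.le_replicate_iff.1 h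
      exact ⟨k, Or.inl ⟨by omega, by omega⟩, by simp [hk']⟩
    · rw [show (v i).toNat = 0 by omega, Multiset.replicate_zero, zero_add] at h
      obtain ⟨k, hk, hk'⟩ := Multiset.le_replicate_iff.1 h
      exact ⟨-k, Or.inr ⟨by omega, by omega⟩, by simp [hk']⟩
  choose u hu hBu using key
  exact ⟨u, hu, Finset.sum_congr rfl fun i _ => hBu i⟩

/-- Subsequences come from conformal vectors, so being an atom reduces to a statement about integer
relations. Injectivity of `f` is not needed. -/
theorem isMinZeroSum_signedSeq {f : ι → G} {v : ι → ℤ} (h0 : v ≠ 0) (hsum : ∑ i, v i • f i = 0)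
    (h : ∀ u, Conformal u v → ∑ i, u i • f i = 0 → u = 0 ∨ u = v) :
    IsMinZeroSum (signedSeq f v) := by
  refine ⟨fun hs => h0 ?_, by rw [sum_signedSeq, hsum], fun T hT hT0 hTs => ?_⟩
  · have := congrArg Multiset.card hs
    rw [card_signedSeq, Multiset.card_zero, Finset.sum_eq_zero_iff] at this
    exact funext fun i => by simpa using this i (Finset.mem_univ i)
  · obtain ⟨u, hu, rfl⟩ := exists_conformal_of_le_signedSeq hT
    rw [sum_signedSeq] at hTs
    rcases h u hu hTs with rfl | rfl
    · simp [signedSeq] at hT0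
    · rfl

theorem sum_sub_smul (f : ι → G) (u v : ι → ℤ) :
    ∑ i, (u - v) i • f i = ∑ i, u i • f i - ∑ i, v i • f i := by
  simp [sub_smul]

theorem sum_add_smul (f : ι → G) (u v : ι → ℤ) :
    ∑ i, (u + v) i • f i = ∑ i, u i • f i + ∑ i, v i • f i := by
  simp [add_smul, Finset.sum_add_distrib]

end SignedSequences

/-! ### Consequences of a congruence between all factorization lengths. -/

section LengthCongr

variable {G : Type*} [AddCommGroup G]

/-- `G₀` is symmetric, does not contain `0`, and any two factorizations of a zero-sum sequence over
`G₀` have lengths that are congruent modulo `ℓ`. -/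
structure LengthCongr (G₀ : Set G) (ℓ : ℕ) : Prop where
  neg_mem : ∀ x ∈ G₀, -x ∈ G₀
  zero_notMem : (0 : G) ∉ G₀
  congr : ∀ X Y : Multiset (Multiset G), (∀ A ∈ X, IsMinZeroSumOver G₀ A) →
    (∀ A ∈ Y, IsMinZeroSumOver G₀ A) → X.sum = Y.sum → (X.card : ZMod ℓ) = Y.card

theorem IsMinZeroSum.neg {A : Multiset G} (hA : IsMinZeroSum A) :
    IsMinZeroSum (A.map (- ·)) := by
  have hneg : ∀ B : Multiset G, (B.map (- ·)).map (- ·) = B := fun B => by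
    rw [Multiset.map_map]; simp
  refine ⟨by simpa using hA.1, by rw [Multiset.sum_map_neg, Multiset.map_id', hA.2.1, neg_zero], fun T hT hT0 hs => ?_⟩
  have h := hA.2.2 (T.map (- ·)) (hneg A ▸ Multiset.map_le_map hT) (by simpa using hT0)
    (by rw [Multiset.sum_map_neg, Multiset.map_id', hs, neg_zero])
  rw [← h, hneg]

theorem isMinZeroSumOver_replicate [Finite G] {G₀ : Set G} {x : G} (hx : x ∈ G₀) :
    IsMinZeroSumOver G₀ (Multiset.replicate (addOrderOf x) x) := by
  refine ⟨⟨?_, ?_, fun T hT hT0 hs => ?_⟩, fun g hg => Multiset.eq_of_mem_replicate hg ▸ hx⟩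
  · rw [← Multiset.card_pos, Multiset.card_replicate]
    exact addOrderOf_pos x
  · rw [Multiset.sum_replicate, addOrderOf_nsmul_eq_zero]
  · obtain ⟨k, hk, rfl⟩ := Multiset.le_replicate_iff.1 hT
    rw [Multiset.sum_replicate] at hs
    have hd := addOrderOf_dvd_of_nsmul_eq_zero hs
    have h0 : k ≠ 0 := by rintro rfl; simp at hT0
    rw [le_antisymm hk (Nat.le_of_dvd (Nat.pos_of_ne_zero h0) hd)]

namespace LengthCongr

variable {G₀ : Set G} {ℓ : ℕ}

theorem pair (hL : LengthCongr G₀ ℓ) {x : G} (hx : x ∈ G₀) : IsMinZeroSumOver G₀ {x, -x} := by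
  refine ⟨isMinZeroSum_pair fun h => hL.zero_notMem (h ▸ hx), fun g hg => ?_⟩
  simp only [Multiset.insert_eq_cons, Multiset.mem_cons, Multiset.mem_singleton] at hg
  rcases hg with rfl | rfl
  · exact hx
  · exact hL.neg_mem _ hx

/-- Compare the two factorizations of (-A)A: into the two atoms A and -A, and into |A| pairs x(-x).
-/
theorem card_eq_two (hL : LengthCongr G₀ ℓ) {A : Multiset G} (hA : IsMinZeroSumOver G₀ A) :
    (A.card : ZMod ℓ) = 2 := by
  have hA' : IsMinZeroSumOver G₀ (A.map (- ·)) := by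
    refine ⟨hA.1.neg, fun g hg => ?_⟩
    obtain ⟨x, hx, rfl⟩ := Multiset.mem_map.1 hg
    exact hL.neg_mem _ (hA.2 x hx)
  have := hL.congr (A.map fun x => {x, -x}) {A, A.map (- ·)} ?_ ?_ ?_
  · simpa using this
  · intro B hB
    obtain ⟨x, hx, rfl⟩ := Multiset.mem_map.1 hB
    exact hL.pair (hA.2 x hx)
  · intro B hB
    simp only [Multiset.insert_eq_cons, Multiset.mem_cons, Multiset.mem_singleton] at hB
    rcases hB with rfl | rfl <;> assumption
  · simp only [Multiset.insert_eq_cons, Multiset.sum_cons, Multiset.sum_singleton]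
    clear hA hA'
    induction A using Multiset.induction with
    | empty => simp
    | cons a A ih =>
      simp only [Multiset.map_cons, Multiset.sum_cons, ih]
      simp only [← Multiset.singleton_add]
      abel

theorem addOrderOf_eq_two [Finite G] (hL : LengthCongr G₀ ℓ) {x : G} (hx : x ∈ G₀) :
    (addOrderOf x : ZMod ℓ) = 2 := by
  simpa using hL.card_eq_two (isMinZeroSumOver_replicate hx)

/-- With g = f i and n = ord(g), multiplying the first atom by (-g)^n gives the second atom times v
i pairs g(-g). The lengths are 2 and 1 + v i. -/
theorem flip [Finite G] {ι : Type*} [Fintype ι] (hL : LengthCongr G₀ ℓ) {f : ι → G}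
    (hf : ∀ i, f i ∈ G₀) {v w : ι → ℤ} {i : ι} (hi : w i = v i - addOrderOf (f i))
    (hw : ∀ j ≠ i, w j = v j) (h0 : 0 ≤ v i) (h1 : v i ≤ addOrderOf (f i))
    (hv' : IsMinZeroSum (signedSeq f v)) (hw' : IsMinZeroSum (signedSeq f w)) :
    ((v i : ℤ) : ZMod ℓ) = 1 := by
  classical
  obtain ⟨a, ha⟩ := Int.eq_ofNat_of_zero_le h0
  have hn : addOrderOf (-f i) = addOrderOf (f i) := addOrderOf_neg _
  have := hL.congr {signedSeq f v, Multiset.replicate (addOrderOf (-f i)) (-f i)}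
    (signedSeq f w ::ₘ Multiset.replicate a {f i, -f i}) ?_ ?_ ?_
  · simp only [Multiset.insert_eq_cons, Multiset.card_cons, Multiset.card_singleton,
      Multiset.card_replicate] at this
    rw [ha]
    push_cast at this ⊢
    linear_combination -this
  · intro B hB
    simp only [Multiset.insert_eq_cons, Multiset.mem_cons, Multiset.mem_singleton] at hB
    rcases hB with rfl | rfl
    · exact ⟨hv', fun g hg => mem_of_mem_signedSeq hf hL.neg_mem hg⟩
    · exact isMinZeroSumOver_replicate (hL.neg_mem _ (hf i))
  · intro B hB
    rcases Multiset.mem_cons.1 hB with rfl | hB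
    · exact ⟨hw', fun g hg => mem_of_mem_signedSeq hf hL.neg_mem hg⟩
    · exact Multiset.eq_of_mem_replicate hB ▸ hL.pair (hf i)
  · rw [Multiset.insert_eq_cons, Multiset.sum_cons, Multiset.sum_singleton, Multiset.sum_cons,
      Multiset.sum_replicate, signedSeq, signedSeq, ← Finset.add_sum_erase _ _ (Finset.mem_univ i),
      ← Finset.add_sum_erase _ _ (Finset.mem_univ i), Finset.sum_congr rfl fun j hj => by
        rw [← hw j (Finset.ne_of_mem_erase hj)], hi, ha, hn]
    ext x
    simp only [Multiset.count_add, Multiset.count_replicate, Multiset.count_nsmul,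
      Multiset.insert_eq_cons, Multiset.count_cons, Multiset.count_singleton, eq_comm (a := x)]
    split_ifs <;> omega

end LengthCongr

end LengthCongr

/-! ### One element against an independent family. -/

section Independence

variable {G : Type*} [AddCommGroup G] {ι : Type*} [Fintype ι]

/-- The elements `f i`, `i ∈ E`, are independent. -/
def IndepOn (f : ι → G) (E : Set ι) : Prop :=
  ∀ u : ι → ℤ, (∀ i ∉ E, u i = 0) → ∑ i, u i • f i = 0 → ∀ i, (addOrderOf (f i) : ℤ) ∣ u i

theorem mem_closure_image_iff {f : ι → G} {E : Set ι} {g : G} :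
    g ∈ AddSubgroup.closure (f '' E) ↔ ∃ u : ι → ℤ, (∀ i ∉ E, u i = 0) ∧ ∑ i, u i • f i = g := by
  classical
  constructor
  · intro h
    induction h using AddSubgroup.closure_induction with
    | mem x hx =>
      obtain ⟨i, hi, rfl⟩ := hx
      refine ⟨Pi.single i 1, fun j hj => ?_, ?_⟩
      · rw [Pi.single_eq_of_ne]
        rintro rfl
        exact hj hi
      · rw [Finset.sum_eq_single i (fun j _ hj => by simp [hj]) (by simp)]
        simp
    | zero => exact ⟨0, fun _ _ => rfl, by simp⟩
    | add x y _ _ hx hy =>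
      obtain ⟨u, hu, rfl⟩ := hx
      obtain ⟨v, hv, rfl⟩ := hy
      exact ⟨u + v, fun i hi => by simp [hu i hi, hv i hi], sum_add_smul f u v⟩
    | neg x _ hx =>
      obtain ⟨u, hu, rfl⟩ := hx
      exact ⟨-u, fun i hi => by simp [hu i hi], by simp⟩
  · rintro ⟨u, hu, rfl⟩
    refine AddSubgroup.sum_mem _ fun i _ => ?_
    by_cases hi : i ∈ E
    · exact zsmul_mem (AddSubgroup.subset_closure (Set.mem_image_of_mem f hi)) _
    · rw [hu i hi, zero_smul]
      exact zero_mem _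

theorem sum_single_smul [DecidableEq ι] (f : ι → G) (i : ι) (k : ℤ) :
    ∑ j, (Pi.single i k : ι → ℤ) j • f j = k • f i := by
  rw [Finset.sum_eq_single i (fun j _ hj => by simp [hj]) (by simp)]
  simp

/-- A relation supported on E has coordinates divisible by the orders, and these coordinates are too
small to be non-zero. -/
theorem Conformal.eq_zero {f : ι → G} {E : Set ι} (hE : IndepOn f E) {o : ι} {u v : ι → ℤ}
    (huv : Conformal u v) (hv : ∀ i ∉ insert o E, v i = 0)
    (hlt : ∀ i ∈ E, |v i| < addOrderOf (f i)) (h0 : u o = 0) (hs : ∑ i, u i • f i = 0) :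
    u = 0 := by
  have hu : ∀ i ∉ E, u i = 0 := fun i hi => by
    rcases eq_or_ne i o with rfl | hio
    · exact h0
    · have h1 := huv i
      rw [hv i (by simp [hi, hio])] at h1
      omega
  funext i
  by_cases hi : i ∈ E
  · refine Int.eq_zero_of_abs_lt_dvd (hE u hu hs i) (lt_of_le_of_lt ?_ (hlt i hi))
    have h1 := huv i
    rw [abs_le]
    rcases le_total 0 (v i) with h | h
    · rw [abs_of_nonneg h]; omega
    · rw [abs_of_nonpos h]; omega
  · exact hu i hi

/-- The coordinate at o of a conformal subrelation u is 0 or -m; then u, respectively v - u, lives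
on E and vanishes. -/
theorem isMinZeroSum_of_neg_order {f : ι → G} {E : Set ι} (hE : IndepOn f E) {o : ι} {m : ℕ}
    (hm : 0 < m)
    (hdvd : ∀ u : ι → ℤ, (∀ i ∉ insert o E, u i = 0) → ∑ i, u i • f i = 0 → (m : ℤ) ∣ u o)
    {v : ι → ℤ} (hv : ∀ i ∉ insert o E, v i = 0) (hlt : ∀ i ∈ E, |v i| < addOrderOf (f i))
    (ho : v o = -m) (hs : ∑ i, v i • f i = 0) : IsMinZeroSum (signedSeq f v) := by
  refine isMinZeroSum_signedSeq (fun h => ?_) hs fun u huv hus => ?_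
  · rw [h, Pi.zero_apply] at ho
    omega
  obtain ⟨k, hk⟩ := hdvd u (fun i hi => by have := huv i; rw [hv i hi] at this; omega) hus
  have h1 := huv o
  rw [ho] at h1
  have hm' : (0 : ℤ) < m := by exact_mod_cast hm
  have hk' : k = 0 ∨ k = -1 := by
    have h2 : -(m : ℤ) ≤ m * k ∧ m * k ≤ 0 := by omega
    have : -1 ≤ k := by nlinarith
    have : k ≤ 0 := by nlinarith
    omega
  rcases hk' with rfl | rfl
  · exact Or.inl (huv.eq_zero hE hv hlt (by simpa using hk) hus)
  · right
    have h2 := huv.sub.eq_zero hE hv hlt (by rw [Pi.sub_apply, ho, hk]; ring)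
      (by rw [sum_sub_smul, hs, hus, sub_zero])
    exact (sub_eq_zero.1 h2).symm

/-- Besides 0 and -2m, the coordinate at o of a subrelation could be -m. Its j-th coordinate would
then be ≡ a j modulo the order of f j, which `hj` forbids between 0 and v j. -/
theorem isMinZeroSum_of_neg_two_mul_order {f : ι → G} {E : Set ι} (hE : IndepOn f E) {o : ι}
    (hoE : o ∉ E) {m : ℕ} (hm : 0 < m)
    (hdvd : ∀ u : ι → ℤ, (∀ i ∉ insert o E, u i = 0) → ∑ i, u i • f i = 0 → (m : ℤ) ∣ u o)
    {a : ι → ℤ} (ha : ∀ i ∉ E, a i = 0) (has : ∑ i, a i • f i = m • f o)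
    {v : ι → ℤ} (hv : ∀ i ∉ insert o E, v i = 0) (hlt : ∀ i ∈ E, |v i| < addOrderOf (f i))
    (ho : v o = -(2 * m)) (hs : ∑ i, v i • f i = 0) {j : ι} (hjE : j ∈ E)
    (hj : ∀ c : ℤ, (0 ≤ c ∧ c ≤ v j) ∨ (v j ≤ c ∧ c ≤ 0) →
      ¬ (addOrderOf (f j) : ℤ) ∣ c - a j) :
    IsMinZeroSum (signedSeq f v) := by
  classical
  refine isMinZeroSum_signedSeq (fun h => ?_) hs fun u huv hus => ?_
  · rw [h, Pi.zero_apply] at ho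
    omega
  have hu : ∀ i ∉ insert o E, u i = 0 := fun i hi => by
    have := huv i; rw [hv i hi] at this; omega
  obtain ⟨k, hk⟩ := hdvd u hu hus
  have h1 := huv o
  rw [ho] at h1
  have hm' : (0 : ℤ) < m := by exact_mod_cast hm
  have hk' : k = 0 ∨ k = -1 ∨ k = -2 := by
    have h2 : -(2 * m : ℤ) ≤ m * k ∧ m * k ≤ 0 := by omega
    have : -2 ≤ k := by nlinarith
    have : k ≤ 0 := by nlinarith
    omega
  rcases hk' with rfl | rfl | rfl
  · exact Or.inl (huv.eq_zero hE hv hlt (by simpa using hk) hus)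
  · exfalso
    refine hj (u j) (huv j) ?_
    have hjo : j ≠ o := by rintro rfl; exact hoE hjE
    have := hE (u + Pi.single o (m : ℤ) - a) (fun i hi => ?_) ?_ j
    · simpa [hjo] using this
    · rcases eq_or_ne i o with rfl | hio
      · simp [hk, ha i hi]
      · simp [hio, ha i hi, hu i (by simp [hi, hio])]
    · rw [sum_sub_smul, sum_add_smul, sum_single_smul, has, hus]
      simp
  · right
    have h2 := huv.sub.eq_zero hE hv hlt (by rw [Pi.sub_apply, ho, hk]; ring)
      (by rw [sum_sub_smul, hs, hus, sub_zero])
    exact (sub_eq_zero.1 h2).symm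

/-- The order of `f o` modulo the subgroup generated by an independent family, with the coordinates
of the corresponding multiple of `f o`. -/
theorem exists_order_mod [Finite G] (f : ι → G) (E : Set ι) (o : ι) (hoE : o ∉ E) :
    ∃ m : ℕ, 0 < m ∧
      (∀ u : ι → ℤ, (∀ i ∉ insert o E, u i = 0) → ∑ i, u i • f i = 0 → (m : ℤ) ∣ u o) ∧
      ∃ a : ι → ℤ, (∀ i ∉ E, a i = 0) ∧ (∀ i, 0 ≤ a i) ∧ (∀ i, a i < addOrderOf (f i)) ∧
        ∑ i, a i • f i = m • f o := by
  classical
  set H := AddSubgroup.closure (f '' E)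
  refine ⟨addOrderOf (QuotientAddGroup.mk (s := H) (f o)), addOrderOf_pos _, fun u hu hs => ?_, ?_⟩
  · rw [addOrderOf_dvd_iff_zsmul_eq_zero, ← QuotientAddGroup.mk_zsmul, QuotientAddGroup.eq_zero_iff]
    refine mem_closure_image_iff.2 ⟨Pi.single o (u o) - u, fun i hi => ?_, ?_⟩
    · rcases eq_or_ne i o with rfl | hio
      · simp
      · simp [hio, hu i (by simp [hi, hio])]
    · rw [sum_sub_smul, sum_single_smul, hs, sub_zero]
  · have hmem : addOrderOf (QuotientAddGroup.mk (s := H) (f o)) • f o ∈ H := by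
      rw [← QuotientAddGroup.eq_zero_iff, QuotientAddGroup.mk_nsmul, addOrderOf_nsmul_eq_zero]
    obtain ⟨u, hu, hs⟩ := mem_closure_image_iff.1 hmem
    have hpos : ∀ i, (0 : ℤ) < addOrderOf (f i) := fun i => by exact_mod_cast addOrderOf_pos (f i)
    refine ⟨fun i => u i % addOrderOf (f i), fun i hi => by simp [hu i hi],
      fun i => Int.emod_nonneg _ (hpos i).ne', fun i => Int.emod_lt_of_pos _ (hpos i), ?_⟩
    rw [← hs]
    exact Finset.sum_congr rfl fun i _ => (mod_addOrderOf_zsmul _ _)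

theorem isMinZeroSum_sub_single [DecidableEq ι] {f : ι → G} {E : Set ι} (hE : IndepOn f E) {o : ι}
    (hoE : o ∉ E) {m : ℕ} (hm : 0 < m)
    (hdvd : ∀ u : ι → ℤ, (∀ i ∉ insert o E, u i = 0) → ∑ i, u i • f i = 0 → (m : ℤ) ∣ u o)
    {a : ι → ℤ} (ha : ∀ i ∉ E, a i = 0) (ha0 : ∀ i, 0 ≤ a i) (ha1 : ∀ i, a i < addOrderOf (f i))
    (has : ∑ i, a i • f i = m • f o) :
    IsMinZeroSum (signedSeq f (a - Pi.single o (m : ℤ))) := by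
  have hEo : ∀ i ∈ E, i ≠ o := by rintro i hi rfl; exact hoE hi
  refine isMinZeroSum_of_neg_order hE hm hdvd (fun i hi => ?_) (fun i hi => ?_) ?_ ?_
  · rw [Set.mem_insert_iff, not_or] at hi
    simp [hi.1, ha i hi.2]
  · simp [hEo i hi, abs_of_nonneg (ha0 i), ha1 i]
  · simp [ha o hoE]
  · rw [sum_sub_smul, sum_single_smul, has]
    simp

/-- The relation and its flip at i both have coordinate -m at o, so both are atoms and
`LengthCongr.flip` applies. -/
theorem LengthCongr.coord_eq_one [Finite G] {G₀ : Set G} {ℓ : ℕ}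
    (hL : LengthCongr G₀ ℓ) {f : ι → G} (hf : ∀ i, f i ∈ G₀) {E : Set ι} (hE : IndepOn f E) {o : ι}
    (hoE : o ∉ E) {m : ℕ} (hm : 0 < m)
    (hdvd : ∀ u : ι → ℤ, (∀ i ∉ insert o E, u i = 0) → ∑ i, u i • f i = 0 → (m : ℤ) ∣ u o)
    {a : ι → ℤ} (ha : ∀ i ∉ E, a i = 0) (ha0 : ∀ i, 0 ≤ a i) (ha1 : ∀ i, a i < addOrderOf (f i))
    (has : ∑ i, a i • f i = m • f o) {i : ι} (hi : a i ≠ 0) :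
    ((a i : ℤ) : ZMod ℓ) = 1 := by
  classical
  have hEo : ∀ i ∈ E, i ≠ o := by rintro i hi rfl; exact hoE hi
  have hEne : ∀ i, a i ≠ 0 → i ∈ E := fun i hi => by
    by_contra h; exact hi (ha i h)
  have hbase := isMinZeroSum_sub_single hE hoE hm hdvd ha ha0 ha1 has
  have hiE := hEne i hi
  have hio := hEo i hiE
  have hpos := ha0 i
  have hlt := ha1 i
  have hflip : IsMinZeroSum
      (signedSeq f (a - Pi.single o (m : ℤ) - Pi.single i (addOrderOf (f i) : ℤ))) := by
    refine isMinZeroSum_of_neg_order hE hm hdvd (fun j hj => ?_) (fun j hj => ?_) ?_ ?_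
    · rw [Set.mem_insert_iff, not_or] at hj
      have hji : j ≠ i := by rintro rfl; exact hj.2 hiE
      simp [hj.1, ha j hj.2, hji]
    · rcases eq_or_ne j i with rfl | hji
      · simp only [Pi.sub_apply, Pi.single_eq_same, Pi.single_eq_of_ne hio, sub_zero]
        rw [abs_lt]
        omega
      · simp [hEo j hj, hji, abs_of_nonneg (ha0 j), ha1 j]
    · simp [ha o hoE, hio.symm]
    · rw [sum_sub_smul, sum_sub_smul, sum_single_smul, sum_single_smul, has]
      simp
  have h1 := hL.flip hf (i := i) (by simp) (fun j hj => by simp [hj]) (by simpa [hio] using hpos)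
    (by simpa [hio] using hlt.le) hbase hflip
  rwa [Pi.sub_apply, Pi.single_eq_of_ne hio, sub_zero] at h1

/-- The atom has length m + ∑ a i, and each non-zero a i counts as 1 modulo ℓ. -/
theorem LengthCongr.card_coord [Finite G] {G₀ : Set G} {ℓ : ℕ}
    (hL : LengthCongr G₀ ℓ) {f : ι → G} (hf : ∀ i, f i ∈ G₀) {E : Set ι} (hE : IndepOn f E) {o : ι}
    (hoE : o ∉ E) {m : ℕ} (hm : 0 < m)
    (hdvd : ∀ u : ι → ℤ, (∀ i ∉ insert o E, u i = 0) → ∑ i, u i • f i = 0 → (m : ℤ) ∣ u o)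
    {a : ι → ℤ} (ha : ∀ i ∉ E, a i = 0) (ha0 : ∀ i, 0 ≤ a i) (ha1 : ∀ i, a i < addOrderOf (f i))
    (has : ∑ i, a i • f i = m • f o) :
    (m : ZMod ℓ) + (Finset.univ.filter (a · ≠ 0)).card = 2 := by
  classical
  have hone := fun i => hL.coord_eq_one hf hE hoE hm hdvd ha ha0 ha1 has (i := i)
  have hbase := isMinZeroSum_sub_single hE hoE hm hdvd ha ha0 ha1 has
  have h2 := hL.card_eq_two ⟨hbase, fun g hg => mem_of_mem_signedSeq hf hL.neg_mem hg⟩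
  rw [card_signedSeq, ← Finset.add_sum_erase _ _ (Finset.mem_univ o)] at h2
  rw [← h2, Finset.card_filter, ← Finset.add_sum_erase _ _ (Finset.mem_univ o)]
  simp only [ha o hoE, Pi.sub_apply, Pi.single_eq_same, zero_sub, Int.natAbs_neg,
    Int.natAbs_natCast, ne_eq, not_true_eq_false, if_false, zero_add]
  push_cast
  congr 1
  refine Finset.sum_congr rfl fun i hi => ?_
  rw [Pi.single_eq_of_ne (Finset.ne_of_mem_erase hi), sub_zero]
  split_ifs with h
  · simp [h]
  · rw [← hone i h, ← Int.cast_natCast, Int.natCast_natAbs, abs_of_nonneg (ha0 i)]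

/-- Otherwise double the relation. One support coordinate i keeps it from splitting into two halves,
while flipping at another coordinate j gives two atoms; so the reduced value of 2 a j would be ≡ 1,
although it is ≡ 2 or ≡ 2 - ord(f j) ≡ 0. -/
theorem LengthCongr.two_mul_smul_eq_zero_or [Finite G] {G₀ : Set G} {ℓ : ℕ} [Fact ℓ.Prime]
    (hL : LengthCongr G₀ ℓ) {f : ι → G} (hf : ∀ i, f i ∈ G₀) {E : Set ι} (hE : IndepOn f E) {o : ι}
    (hoE : o ∉ E) {m : ℕ} (hm : 0 < m)
    (hdvd : ∀ u : ι → ℤ, (∀ i ∉ insert o E, u i = 0) → ∑ i, u i • f i = 0 → (m : ℤ) ∣ u o)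
    {a : ι → ℤ} (ha : ∀ i ∉ E, a i = 0) (ha0 : ∀ i, 0 ≤ a i) (ha1 : ∀ i, a i < addOrderOf (f i))
    (has : ∑ i, a i • f i = m • f o) :
    (2 * m) • f o = 0 ∨ (Finset.univ.filter (a · ≠ 0)).card ≤ 1 := by
  classical
  have hone := fun i => hL.coord_eq_one hf hE hoE hm hdvd ha ha0 ha1 has (i := i)
  have hEo : ∀ i ∈ E, i ≠ o := by rintro i hi rfl; exact hoE hi
  have hEne : ∀ i, a i ≠ 0 → i ∈ E := fun i hi => by
    by_contra h; exact hi (ha i h)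
  by_contra! hcon
  obtain ⟨h2m, hcard⟩ := hcon
  obtain ⟨j, hj⟩ : ∃ j, ¬ (addOrderOf (f j) : ℤ) ∣ 2 * a j := by
    by_contra! hall
    apply h2m
    rw [mul_smul, ← has, Finset.smul_sum]
    refine Finset.sum_eq_zero fun i _ => ?_
    have := hall i
    rw [addOrderOf_dvd_iff_zsmul_eq_zero, mul_smul] at this
    exact_mod_cast this
  obtain ⟨i, hi, hij⟩ := Finset.exists_mem_ne hcard j
  have hi0 : a i ≠ 0 := (Finset.mem_filter.1 hi).2
  have hj0 : a j ≠ 0 := fun h => hj (by simp [h])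
  have hiE := hEne i hi0
  have hjE := hEne j hj0
  obtain ⟨b, hbdef⟩ : ∃ b : ι → ℤ, b = fun i =>
    if 2 * a i < addOrderOf (f i) then 2 * a i else 2 * a i - addOrderOf (f i) := ⟨_, rfl⟩
  have hb : ∀ k, (2 * a k < addOrderOf (f k) ∧ b k = 2 * a k) ∨
      ((addOrderOf (f k) : ℤ) ≤ 2 * a k ∧ b k = 2 * a k - addOrderOf (f k)) := fun k => by
    simp only [hbdef]
    split_ifs <;> omega
  have hb0 : ∀ k, 0 ≤ b k := fun k => by have := hb k; have := ha0 k; omega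
  have hb1 : ∀ k, b k < addOrderOf (f k) := fun k => by have := hb k; have := ha1 k; omega
  have hbE : ∀ k ∉ E, b k = 0 := fun k hk => by
    have := hb k
    rw [ha k hk] at this
    have := addOrderOf_pos (f k)
    omega
  have hbs : ∑ k, b k • f k = (2 * m) • f o := by
    rw [mul_smul, ← has, Finset.smul_sum]
    refine Finset.sum_congr rfl fun k _ => ?_
    rcases hb k with h | h
    · rw [h.2, mul_smul]; norm_cast
    · rw [h.2, sub_smul, mul_smul, natCast_zsmul, addOrderOf_nsmul_eq_zero, sub_zero]; norm_cast
  -- Choose the representative of 2 a i for which the interval from 0 misses the class of a i: take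
  -- 2 a i - ord(f i) in both cases, which is negative or zero or lies below a i.
  obtain ⟨e, he, hej⟩ : ∃ e : ℤ, (e = 0 ∨ (e = addOrderOf (f i) ∧ b i ≠ 0)) ∧
      (∀ c : ℤ, (0 ≤ c ∧ c ≤ b i - e) ∨ (b i - e ≤ c ∧ c ≤ 0) →
        ¬ (addOrderOf (f i) : ℤ) ∣ c - a i) := by
    have h0 := ha0 i
    have h1 := ha1 i
    rcases hb i with h | h
    · refine ⟨_, Or.inr ⟨rfl, by omega⟩, fun c hc hd => ?_⟩
      have := Int.eq_zero_of_abs_lt_dvd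
        (show (addOrderOf (f i) : ℤ) ∣ c - a i + addOrderOf (f i) from dvd_add hd dvd_rfl)
        (by rw [abs_lt]; omega)
      omega
    · refine ⟨_, Or.inl rfl, fun c hc hd => ?_⟩
      have := Int.eq_zero_of_abs_lt_dvd hd (by rw [abs_lt]; omega)
      omega
  have hes : e • f i = 0 := by
    rcases he with rfl | ⟨rfl, -⟩
    · simp
    · rw [natCast_zsmul, addOrderOf_nsmul_eq_zero]
  have hio := hEo i hiE
  have hjo := hEo j hjE
  have hbio : |b i - e| < addOrderOf (f i) := by
    have := hb0 i
    have := hb1 i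
    rw [abs_lt]; omega
  have hkey : ∀ d : ℤ, (d = 0 ∨ d = addOrderOf (f j)) → |b j - d| < addOrderOf (f j) →
      IsMinZeroSum (signedSeq f
        (b - Pi.single o (2 * m : ℤ) - Pi.single i e - Pi.single j d)) := by
    intro d hd hdlt
    have hds : d • f j = 0 := by
      rcases hd with rfl | rfl
      · simp
      · rw [natCast_zsmul, addOrderOf_nsmul_eq_zero]
    refine isMinZeroSum_of_neg_two_mul_order hE hoE hm hdvd ha has (fun k hk => ?_)
      (fun k hk => ?_) ?_ ?_ hiE (by simpa [hio, hij] using hej)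
    · rw [Set.mem_insert_iff, not_or] at hk
      have hki : k ≠ i := by rintro rfl; exact hk.2 hiE
      have hkj : k ≠ j := by rintro rfl; exact hk.2 hjE
      simp [hk.1, hbE k hk.2, hki, hkj]
    · have hko := hEo k hk
      rcases eq_or_ne k i with rfl | hki
      · simpa [hko, hij] using hbio
      rcases eq_or_ne k j with rfl | hkj
      · simpa [hko, hki] using hdlt
      · simp [hko, hki, hkj, abs_of_nonneg (hb0 k), hb1 k]
    · simp [hbE o hoE, hio.symm, hjo.symm]
    · rw [sum_sub_smul, sum_sub_smul, sum_sub_smul, sum_single_smul, sum_single_smul,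
        sum_single_smul, hbs, hes, hds]
      rw [← natCast_zsmul]
      simp
  have hbj : b j ≠ 0 := fun h => by
    rcases hb j with h' | h'
    · have := ha0 j; omega
    · exact hj ⟨1, by omega⟩
  have hflip := hL.flip hf (i := j) (by simp) (fun k hk => by simp [hk])
    (by simpa [hjo, hij.symm] using hb0 j) (by simpa [hjo, hij.symm] using (hb1 j).le)
    (hkey 0 (Or.inl rfl) (by rw [sub_zero, abs_of_nonneg (hb0 j)]; exact hb1 j))
    (hkey _ (Or.inr rfl) (by have := hb0 j; have := hb1 j; rw [abs_lt]; omega))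
  simp only [Pi.sub_apply, Pi.single_eq_of_ne hjo, Pi.single_eq_of_ne hij.symm, sub_zero,
    Pi.single_zero, Pi.zero_apply] at hflip
  have h1 := hone j hj0
  have h2 := hL.addOrderOf_eq_two (hf j)
  rcases hb j with h' | h' <;> rw [h'.2] at hflip <;> push_cast at hflip <;> rw [h1] at hflip
  · exact one_ne_zero (by linear_combination hflip : (1 : ZMod ℓ) = 0)
  · rw [h2] at hflip
    exact one_ne_zero (by linear_combination -hflip : (1 : ZMod ℓ) = 0)

/-- The main restriction on an element in terms of an independent family. -/
theorem LengthCongr.exists_order_mod [Finite G] {G₀ : Set G} {ℓ : ℕ} [Fact ℓ.Prime]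
    (hL : LengthCongr G₀ ℓ) {f : ι → G} (hf : ∀ i, f i ∈ G₀) {E : Set ι} (hE : IndepOn f E) {o : ι}
    (hoE : o ∉ E) :
    ∃ m : ℕ, 0 < m ∧
      (∀ u : ι → ℤ, (∀ i ∉ insert o E, u i = 0) → ∑ i, u i • f i = 0 → (m : ℤ) ∣ u o) ∧
      ∃ a : ι → ℤ, (∀ i ∉ E, a i = 0) ∧ (∀ i, 0 ≤ a i) ∧ (∀ i, a i < addOrderOf (f i)) ∧
        ∑ i, a i • f i = m • f o ∧ (∀ i, a i ≠ 0 → ((a i : ℤ) : ZMod ℓ) = 1) ∧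
        ((m : ZMod ℓ) + (Finset.univ.filter (a · ≠ 0)).card = 2) ∧
        ((2 * m) • f o = 0 ∨ (Finset.univ.filter (a · ≠ 0)).card ≤ 1) := by
  obtain ⟨m, hm, hdvd, a, ha, ha0, ha1, has⟩ := ZeroSum.exists_order_mod f E o hoE
  exact ⟨m, hm, hdvd, a, ha, ha0, ha1, has,
    fun i => hL.coord_eq_one hf hE hoE hm hdvd ha ha0 ha1 has,
    hL.card_coord hf hE hoE hm hdvd ha ha0 ha1 has,
    hL.two_mul_smul_eq_zero_or hf hE hoE hm hdvd ha ha0 ha1 has⟩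

end Independence

/-! ### Independent subfamilies of generating families in p-groups. -/

section Bases

variable {G : Type*} [AddCommGroup G] {ι : Type*}

theorem mem_closure_smul_image {f : ι → G} {n : ℕ} {E : Set ι} {g : G} :
    g ∈ AddSubgroup.closure ((fun i => n • f i) '' E) ↔
      ∃ h ∈ AddSubgroup.closure (f '' E), g = n • h := by
  rw [show (fun i => n • f i) '' E = (nsmulAddMonoidHom n : G →+ G) '' (f '' E) by
    rw [Set.image_image]; rfl, ← AddMonoidHom.map_closure, AddSubgroup.mem_map]
  simp [eq_comm]

variable [Fintype ι]

/-- A basis of the span of a finite family in an elementary `p`-group. -/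
theorem exists_basis_of_smul_eq_zero {p : ℕ} (hp : p.Prime) {w : ι → G} (hw : ∀ i, p • w i = 0) :
    ∃ E : Set ι, (∀ u : ι → ℤ, (∀ i ∉ E, u i = 0) → ∑ i, u i • w i = 0 → ∀ i, (p : ℤ) ∣ u i) ∧
      ∀ o, w o ∈ AddSubgroup.closure (w '' E) := by
  classical
  obtain ⟨E, hE⟩ := (Set.toFinite {E : Set ι | ∀ u : ι → ℤ, (∀ i ∉ E, u i = 0) →
    ∑ i, u i • w i = 0 → ∀ i, (p : ℤ) ∣ u i}).exists_maximal
    ⟨∅, fun u hu _ i => by simp [hu i (Set.notMem_empty i)]⟩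
  refine ⟨E, hE.prop, fun o => ?_⟩
  by_cases hoE : o ∈ E
  · exact AddSubgroup.subset_closure (Set.mem_image_of_mem w hoE)
  obtain ⟨u, hu, hs, i, hi⟩ : ∃ u : ι → ℤ, (∀ i ∉ insert o E, u i = 0) ∧
      ∑ i, u i • w i = 0 ∧ ∃ i, ¬ (p : ℤ) ∣ u i := by
    by_contra! h
    exact hoE (hE.le_of_ge h (Set.subset_insert o E) (Set.mem_insert o E))
  have hsupp : ∀ j ∉ E, (u - Pi.single o (u o) : ι → ℤ) j = 0 := fun j hj => by
    rcases eq_or_ne j o with rfl | hjo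
    · simp
    · simp [hjo, hu j (by simp [hj, hjo])]
  have hsum : ∑ j, (u - Pi.single o (u o) : ι → ℤ) j • w j = -(u o • w o) := by
    rw [sum_sub_smul, sum_single_smul, hs, zero_sub]
  have hnd : ¬ (p : ℤ) ∣ u o := fun hd => by
    have h0 : u o • w o = 0 := by
      obtain ⟨k, hk⟩ := hd
      rw [hk, mul_comm, mul_smul, natCast_zsmul, hw, smul_zero]
    have h1 := hE.prop _ hsupp (by rw [hsum, h0, neg_zero]) i
    rcases eq_or_ne i o with rfl | hio
    · exact hi hd
    · exact hi (by simpa [hio] using h1)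
  -- The coefficient at o is invertible modulo p, so the relation can be solved for w o.
  obtain ⟨x, y, hxy⟩ := (Nat.prime_iff_prime_int.1 hp).coprime_iff_not_dvd.2 hnd
  have : w o = y • (u o • w o) := by
    have : (x * p + y * u o) • w o = w o := by rw [hxy, one_smul]
    rwa [add_smul, mul_smul, mul_smul, natCast_zsmul, hw, smul_zero, zero_add, eq_comm] at this
  rw [this]
  refine zsmul_mem (neg_mem_iff.1 ?_) _
  exact mem_closure_image_iff.2 ⟨_, hsupp, hsum⟩

/-- In a group of exponent `p ^ s`, if the socle of `p ^ j G` lies in `p ^ (s - 1) G`, then every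
generating family contains independent elements of order `p ^ s` whose span contains `p ^ j G`. -/
theorem exists_indep_of_socle {f : ι → G} (hspan : AddSubgroup.closure (Set.range f) = ⊤)
    {p s j : ℕ} (hp : p.Prime) (hs : 1 ≤ s) (hexp : ∀ x : G, p ^ s • x = 0)
    (hsoc : ∀ y : G, p • p ^ j • y = 0 → ∃ z : G, p ^ j • y = p ^ (s - 1) • z) :
    ∃ E : Set ι,
      (∀ u : ι → ℤ, (∀ i ∉ E, u i = 0) → ∑ i, u i • f i = 0 → ∀ i, ((p ^ s : ℕ) : ℤ) ∣ u i) ∧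
      (∀ y : G, p ^ j • y ∈ AddSubgroup.closure (f '' E)) ∧
      ∀ y : G, ∃ h ∈ AddSubgroup.closure (f '' E), p ^ (s - 1) • y = p ^ (s - 1) • h := by
  obtain ⟨E, hE, hEspan⟩ := exists_basis_of_smul_eq_zero hp (w := fun i => p ^ (s - 1) • f i)
    (fun i => by rw [← mul_smul, mul_pow_sub_one (by omega), hexp])
  have hred : ∀ y : G, ∃ h ∈ AddSubgroup.closure (f '' E), p ^ (s - 1) • y = p ^ (s - 1) • h := by
    intro y
    rw [← mem_closure_smul_image]
    have hy : p ^ (s - 1) • y ∈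
        AddSubgroup.closure ((fun i => p ^ (s - 1) • f i) '' Set.univ) :=
      mem_closure_smul_image.2 ⟨y, by rw [Set.image_univ, hspan]; trivial, rfl⟩
    refine (AddSubgroup.closure_le _).2 ?_ hy
    rintro _ ⟨i, -, rfl⟩
    exact hEspan i
  refine ⟨E, fun u hu hsum => ?_, fun y => ?_, hred⟩
  -- Once u = p^t v, multiplying the relation by p^(s-1-t) gives a relation between the p^(s-1) f i
  -- with coefficients v, so p divides v.
  · have key : ∀ t ≤ s, ∀ i, ((p ^ t : ℕ) : ℤ) ∣ u i := by
      intro t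
      induction t with
      | zero => simp
      | succ t ih =>
        intro ht i
        choose v hv using ih (by omega)
        have hp0 : ((p ^ t : ℕ) : ℤ) ≠ 0 := by exact_mod_cast (pow_pos hp.pos t).ne'
        have h1 := hE v (fun k hk => by simpa [hp.ne_zero, hu k hk] using hv k) ?_ i
        · rw [hv i, pow_succ, Nat.cast_mul]
          exact mul_dvd_mul_left _ h1
        · have : ∑ k, v k • p ^ (s - 1) • f k = p ^ (s - 1 - t) • ∑ k, u k • f k := by
            rw [Finset.smul_sum]
            refine Finset.sum_congr rfl fun k _ => ?_
            rw [hv k, ← natCast_zsmul, ← natCast_zsmul, smul_smul, smul_smul]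
            congr 1
            rw [mul_comm, ← mul_assoc, ← Nat.cast_mul, ← pow_add]
            congr 4
            omega
          rw [this, hsum, smul_zero]
    exact key s le_rfl
  -- Induction on the exponent killing p^j y: by the socle condition its last non-zero multiple is
  -- p^(s-1) h with h in the span, and subtracting a multiple of h from y lowers the exponent.
  · have key : ∀ t : ℕ, ∀ y : G, p ^ t • p ^ j • y = 0 →
        p ^ j • y ∈ AddSubgroup.closure (f '' E) := by
      intro t
      induction t with
      | zero =>
        intro y hy
        rw [pow_zero, one_smul] at hy
        rw [hy]
        exact zero_mem _
      | succ t ih =>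
        intro y hy
        by_cases hts : s ≤ t + j
        · refine ih y ?_
          rw [smul_smul, ← pow_add, ← Nat.sub_add_cancel hts, pow_add, mul_smul, hexp, smul_zero]
        obtain ⟨z, hz⟩ := hsoc (p ^ t • y) (by
          rw [smul_comm (p ^ j), smul_smul, ← pow_succ']; exact hy)
        obtain ⟨h, hh, hzh⟩ := hred z
        have hpow : p ^ (s - 1) • h = p ^ t • p ^ j • p ^ (s - 1 - t - j) • h := by
          rw [smul_smul, smul_smul, ← pow_add, ← pow_add]
          congr 2
          omega
        have h1 := ih (y - p ^ (s - 1 - t - j) • h) (by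
          rw [smul_sub, smul_sub, ← hpow, ← hzh, ← hz, smul_comm, sub_self])
        rw [smul_sub] at h1
        have h2 : p ^ j • p ^ (s - 1 - t - j) • h ∈ AddSubgroup.closure (f '' E) :=
          nsmul_mem (nsmul_mem hh _) _
        simpa using add_mem h1 h2
    exact key s y (hexp _)

end Bases

/-! ### Tools for p-groups. -/

section PrimePower

variable {G : Type*} [AddCommGroup G]

/-- The complement for `IsMinZeroSum.false_of_splitting` is the span of the other members of the
family. -/
theorem IsMinZeroSum.false_of_indepOn [Finite G] (hG : ¬ IsAddCyclic G) {U : Multiset G}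
    (hU : IsMinZeroSum U) (hc : U.card = davenport G) {ι : Type*} [Fintype ι] {f : ι → G}
    (hf : ∀ i, f i ∈ U) {E : Set ι} (hE : IndepOn f E) {b : ι} (hbE : b ∈ E)
    (hb : 2 < addOrderOf (f b))
    (h : ∀ g ∈ U, 2 • g = 0 ∨ ∃ e ∈ E, g ∈ AddSubgroup.zmultiples (f e)) : False := by
  classical
  refine hU.false_of_splitting hG hc (hf b) hb (AddSubgroup.closure (f '' (E \ {b})))
    (fun x hx hxb => ?_) fun g hg => ?_
  · obtain ⟨u, hu, hs⟩ := mem_closure_image_iff.1 hx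
    obtain ⟨k, rfl⟩ := AddSubgroup.mem_zmultiples_iff.1 hxb
    have h1 := hE (Pi.single b k - u) (fun i hi => ?_) ?_ b
    · rw [← addOrderOf_dvd_iff_zsmul_eq_zero]
      simpa [hu b (by simp)] using h1
    · have hib : i ≠ b := by rintro rfl; exact hi hbE
      simp [hib, hu i (by simp [hi])]
    · rw [sum_sub_smul, sum_single_smul, hs, sub_self]
  · rcases h g hg with h2 | ⟨e, he, hge⟩
    · right; rw [h2]; exact zero_mem _
    by_cases heb : e = b
    · left; rwa [← heb]
    · right
      obtain ⟨k, rfl⟩ := AddSubgroup.mem_zmultiples_iff.1 hge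
      exact nsmul_mem (zsmul_mem (AddSubgroup.subset_closure (Set.mem_image_of_mem f
        (show e ∈ E \ {b} from ⟨he, heb⟩))) _) _

theorem exists_smul_ne_zero_of_closure {G : Type*} [AddCommGroup G] {U : Multiset G}
    (h : AddSubgroup.closure {g | g ∈ U} = ⊤) {n : ℕ} (hn : ¬ AddMonoid.exponent G ∣ n) :
    ∃ g ∈ U, n • g ≠ 0 := by
  by_contra! hall
  refine hn (AddMonoid.exponent_dvd_of_forall_nsmul_eq_zero fun g => ?_)
  have hg : g ∈ AddSubgroup.closure {g | g ∈ U} := h ▸ AddSubgroup.mem_top g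
  exact (AddSubgroup.closure_le (nsmulAddMonoidHom n : G →+ G).ker).2 (fun x hx => hall x hx) hg

theorem mem_symmSupp {U : Multiset G} {g : G} (h : g ∈ U) : g ∈ symmSupp U := Or.inl h

/-- Makes a term of order p^s₁ modulo the span have order p^s₁ in G. Here s₁ ∣ s₂ enters: p^s₁ ≡ 1
would give p^s₂ ≡ 1, not 2. So the support of a is not a singleton, and if it is non-empty then 2
p^s₁ f o = 0, which leaves only p = 2. -/
theorem smul_eq_zero_of_coord [Finite G] {G₀ : Set G} {ℓ : ℕ} [Fact ℓ.Prime]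
    (hL : LengthCongr G₀ ℓ) {ι : Type*} [Fintype ι] {f : ι → G} (hf : ∀ i, f i ∈ G₀) {E : Set ι}
    {p s₁ s₂ : ℕ} (hp : p.Prime) (hdvd : s₁ ∣ s₂) (hne : p ^ s₂ ≠ 2) (h2 : 1 ≤ s₂)
    (hexp : ∀ x : G, p ^ s₂ • x = 0) (hn : ((p ^ s₂ : ℕ) : ZMod ℓ) = 2)
    (hE : ∀ u : ι → ℤ, (∀ i ∉ E, u i = 0) → ∑ i, u i • f i = 0 →
      ∀ i, ((p ^ s₂ : ℕ) : ℤ) ∣ u i) {o : ι} {a : ι → ℤ} (ha : ∀ i ∉ E, a i = 0)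
    (ha0 : ∀ i, 0 ≤ a i) (ha1 : ∀ i, a i < addOrderOf (f i))
    (has : ∑ i, a i • f i = p ^ s₁ • f o) (hord : p ^ s₁ ∣ addOrderOf (f o))
    (hone : ∀ i, a i ≠ 0 → ((a i : ℤ) : ZMod ℓ) = 1)
    (hcard : ((p ^ s₁ : ℕ) : ZMod ℓ) + (Finset.univ.filter (a · ≠ 0)).card = 2)
    (hsupp : (2 * p ^ s₁) • f o = 0 ∨ (Finset.univ.filter (a · ≠ 0)).card ≤ 1) :
    p ^ s₁ • f o = 0 := by
  have hk1 : ((p ^ s₁ : ℕ) : ZMod ℓ) ≠ 1 := fun h => by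
    obtain ⟨t, rfl⟩ := hdvd
    rw [pow_mul, Nat.cast_pow, h, one_pow] at hn
    exact one_ne_zero (by linear_combination -hn : (1 : ZMod ℓ) = 0)
  by_contra hne0
  have hc0 : (Finset.univ.filter (a · ≠ 0)).card ≠ 0 := fun h => by
    rw [Finset.card_eq_zero, Finset.filter_eq_empty_iff] at h
    refine hne0 (has ▸ Finset.sum_eq_zero fun i hi => ?_)
    rw [not_not.1 (h hi), zero_smul]
  have hc1 : (Finset.univ.filter (a · ≠ 0)).card ≠ 1 := fun h => by
    rw [h] at hcard
    exact hk1 (by push_cast at hcard ⊢; linear_combination hcard)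
  have h2x := hsupp.resolve_right (by omega)
  have hp2 : p = 2 := by
    by_contra hp2
    have hcop : Nat.Coprime 2 (p ^ s₂) :=
      Nat.Coprime.pow_right _ ((Nat.coprime_primes Nat.prime_two hp).2 (Ne.symm hp2))
    refine hne0 (AddMonoid.addOrderOf_eq_one_iff.1 (Nat.eq_one_of_dvd_coprimes hcop ?_ ?_))
    · exact addOrderOf_dvd_of_nsmul_eq_zero (by rw [smul_smul, h2x])
    · exact addOrderOf_dvd_of_nsmul_eq_zero (hexp _)
  subst hp2
  obtain ⟨i, hi⟩ := Finset.card_pos.1 (Nat.pos_of_ne_zero hc0)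
  have hai : a i ≠ 0 := (Finset.mem_filter.1 hi).2
  have hd := hE (fun k => 2 * a k) (fun k hk => by simp [ha k hk]) (by
    simp only [mul_smul]
    rw [← Finset.smul_sum, has]
    rw [mul_smul] at h2x
    exact_mod_cast h2x) i
  have hlt : a i < ((2 ^ s₂ : ℕ) : ℤ) := (ha1 i).trans_le (by
    exact_mod_cast Nat.le_of_dvd (by positivity) (addOrderOf_dvd_of_nsmul_eq_zero (hexp (f i))))
  have hs2 : 2 ≤ s₂ := by
    by_contra h
    exact hne (by rw [show s₂ = 1 by omega, pow_one])
  have hpow : 2 ^ s₂ = 2 * 2 ^ (s₂ - 1) := (mul_pow_sub_one (by omega) 2).symm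
  -- This value is even as s₂ ≥ 2, and it is ≡ 1; hence 2 ≠ 0 modulo ℓ and can be cancelled from
  -- ord(f o) = 2 · 2^s₁ ≡ 2.
  have ha2 : a i = ((2 ^ (s₂ - 1) : ℕ) : ℤ) := by
    obtain ⟨k, hk⟩ := hd
    have := ha0 i
    rw [hpow] at hk hlt
    push_cast at hk hlt ⊢
    have hpos : (0 : ℤ) < 2 ^ (s₂ - 1) := by positivity
    have : k = 1 := by
      have : 0 < k := by
        by_contra! h
        have : 0 < a i := by omega
        nlinarith
      have : k < 2 := by nlinarith
      omega
    subst this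
    linarith
  have h1 := hone i hai
  rw [ha2, Int.cast_natCast] at h1
  have h20 : (2 : ZMod ℓ) ≠ 0 := fun h => by
    rw [← mul_pow_sub_one (show s₂ - 1 ≠ 0 by omega)] at h1
    push_cast at h1
    rw [h, zero_mul] at h1
    exact zero_ne_one h1
  have ho : addOrderOf (f o) = 2 * 2 ^ s₁ := by
    obtain ⟨c, hc⟩ := hord
    have hdv : 2 ^ s₁ * c ∣ 2 ^ s₁ * 2 := by
      rw [← hc, mul_comm]
      exact addOrderOf_dvd_of_nsmul_eq_zero h2x
    rcases (Nat.dvd_prime Nat.prime_two).1 (Nat.dvd_of_mul_dvd_mul_left (by positivity) hdv)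
      with rfl | rfl
    · refine absurd ?_ hne0
      rw [mul_one] at hc
      rw [← hc, addOrderOf_nsmul_eq_zero]
    · rw [hc, mul_comm]
  have h3 := hL.addOrderOf_eq_two (hf o)
  rw [ho, Nat.cast_mul] at h3
  refine hk1 (mul_left_cancel₀ h20 ?_)
  rw [mul_one]
  exact_mod_cast h3

theorem sum_smul_of_card_le_one {ι : Type*} [Fintype ι] {f : ι → G} {a : ι → ℤ}
    (h : (Finset.univ.filter (a · ≠ 0)).card ≤ 1) :
    ((Finset.univ.filter (a · ≠ 0)).card = 0 ∧ ∑ i, a i • f i = 0) ∨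
      ∃ e, a e ≠ 0 ∧ (Finset.univ.filter (a · ≠ 0)).card = 1 ∧ ∑ i, a i • f i = a e • f e := by
  have hsum : ∑ i, a i • f i = ∑ i ∈ Finset.univ.filter (a · ≠ 0), a i • f i := by
    refine (Finset.sum_filter_of_ne (p := (a · ≠ 0)) fun i _ hi h0 => hi ?_).symm
    rw [h0, zero_smul]
  rcases Nat.le_one_iff_eq_zero_or_eq_one.1 h with h0 | h1
  · rw [hsum, Finset.card_eq_zero.1 h0]
    simp
  · obtain ⟨e, he⟩ := Finset.card_eq_one.1 h1
    refine Or.inr ⟨e, ?_, h1, by rw [hsum, he, Finset.sum_singleton]⟩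
    have hmem : e ∈ Finset.univ.filter (a · ≠ 0) := he ▸ Finset.mem_singleton_self e
    exact (Finset.mem_filter.1 hmem).2

theorem two_smul_eq_zero_or_mem_zmultiples {ι : Type*} [Fintype ι] {f : ι → G} {E : Set ι}
    {a : ι → ℤ} (ha : ∀ i ∉ E, a i = 0) {g : G} (has : ∑ i, a i • f i = 1 • g)
    (hsupp : (2 * 1) • g = 0 ∨ (Finset.univ.filter (a · ≠ 0)).card ≤ 1) :
    2 • g = 0 ∨ ∃ e ∈ E, g ∈ AddSubgroup.zmultiples (f e) := by
  refine hsupp.elim Or.inl fun h => ?_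
  rw [one_smul] at has
  rcases sum_smul_of_card_le_one (f := f) h with ⟨-, h0⟩ | ⟨e, he, -, h1⟩
  · left
    rw [← has, h0, smul_zero]
  · refine Or.inr ⟨e, not_imp_comm.1 (ha e) he, a e, ?_⟩
    rw [← has, h1]

end PrimePower

/-! ### Groups of the form C_{p^s₁}^r₁ ⊕ C_{p^s₂}^r₂. -/

section PrimePower

variable {G : Type*} [AddCommGroup G]

/-- The socle conditions say that cyclic factors have order p^s₁ or p^s₂ only. A basis of G is
extracted from U: first E with terms of order p^s₂, then F lifting a basis of the quotient by the
span of E. -/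
theorem IsMinZeroSum.false_of_primePower [Finite G] (hG : ¬ IsAddCyclic G) {U : Multiset G}
    (hU : IsMinZeroSum U) (hc : U.card = davenport G) {ℓ : ℕ} [Fact ℓ.Prime]
    (hL : LengthCongr (symmSupp U) ℓ) {p s₁ s₂ : ℕ} (hp : p.Prime) (h1 : 1 ≤ s₁) (h2 : 1 ≤ s₂)
    (hdvd : s₁ ∣ s₂) (hexp : AddMonoid.exponent G = p ^ s₂) (hne : p ^ s₂ ≠ 2)
    (hsoc : ∀ y : G, p • p ^ s₁ • y = 0 → ∃ z : G, p ^ s₁ • y = p ^ (s₂ - 1) • z)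
    (hsoc' : ∀ y : G, p • y = 0 → ∃ z : G, y = p ^ (s₁ - 1) • z) : False := by
  classical
  have := Fintype.ofFinite G
  let f : {x // x ∈ U} → G := Subtype.val
  have hf : ∀ i, f i ∈ symmSupp U := fun i => mem_symmSupp i.2
  have hspan : AddSubgroup.closure (Set.range f) = ⊤ := by
    rw [Subtype.range_coe_subtype]
    exact hU.closure_eq_top hc
  have hexp' : ∀ x : G, p ^ s₂ • x = 0 := fun x => by
    rw [← hexp, AddMonoid.exponent_nsmul_eq_zero]
  have hords : ∀ x : G, (addOrderOf x : ℤ) ∣ ((p ^ s₂ : ℕ) : ℤ) := fun x =>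
    Int.natCast_dvd_natCast.2 (addOrderOf_dvd_of_nsmul_eq_zero (hexp' x))
  obtain ⟨E, hE, hkE, hrE⟩ := exists_indep_of_socle hspan hp h2 hexp' hsoc
  have hEind : IndepOn f E := fun u hu hs i => (hords _).trans (hE u hu hs i)
  have hordE : ∀ i ∈ E, addOrderOf (f i) = p ^ s₂ := fun i hi => by
    refine Nat.dvd_antisymm (addOrderOf_dvd_of_nsmul_eq_zero (hexp' _)) ?_
    have := hE (Pi.single i (addOrderOf (f i) : ℤ)) (fun j hj => ?_) ?_ i
    · simpa using Int.natCast_dvd_natCast.1 (by simpa using this)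
    · have hji : j ≠ i := by rintro rfl; exact hj hi
      simp [hji]
    · rw [sum_single_smul, natCast_zsmul, addOrderOf_nsmul_eq_zero]
  obtain ⟨b, hbE⟩ : E.Nonempty := by
    by_contra hempty
    rw [Set.not_nonempty_iff_eq_empty] at hempty
    have hd : AddMonoid.exponent G ∣ p ^ (s₂ - 1) := by
      refine AddMonoid.exponent_dvd_of_forall_nsmul_eq_zero fun g => ?_
      obtain ⟨h, hh, hgh⟩ := hrE g
      rw [hempty, Set.image_empty, AddSubgroup.closure_empty, AddSubgroup.mem_bot] at hh
      rw [hgh, hh, smul_zero]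
    rw [hexp, Nat.pow_dvd_pow_iff_le_right hp.one_lt] at hd
    omega
  have hn : ((p ^ s₂ : ℕ) : ZMod ℓ) = 2 := hordE b hbE ▸ hL.addOrderOf_eq_two (hf b)
  set H := AddSubgroup.closure (f '' E) with hH
  let π : G →+ G ⧸ H := QuotientAddGroup.mk' H
  have hπ : ∀ x, π x = 0 ↔ x ∈ H := fun x => QuotientAddGroup.eq_zero_iff x
  have hπs : Function.Surjective π := QuotientAddGroup.mk'_surjective H
  have hspanQ : AddSubgroup.closure (Set.range (π ∘ f)) = ⊤ := by
    rw [Set.range_comp, ← AddMonoidHom.map_closure, hspan, ← AddMonoidHom.range_eq_map,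
      AddMonoidHom.range_eq_top.2 hπs]
  obtain ⟨F, hF, hkF, -⟩ := exists_indep_of_socle (j := 0) hspanQ hp h1
    (fun x => by
      obtain ⟨y, rfl⟩ := hπs x
      rw [← map_nsmul, hπ]
      exact hkE y)
    (fun x hx => by
      obtain ⟨y, rfl⟩ := hπs x
      rw [pow_zero, one_smul, ← map_nsmul, hπ, hH, mem_closure_image_iff] at hx
      obtain ⟨u, hu, hs⟩ := hx
      -- If p y lies in the span H, it lies in pH, so y can be corrected by an element of H to be
      -- killed by p; then `hsoc'` applies.
      have hpu : ∀ i, (p : ℤ) ∣ u i := fun i => by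
        have := hE (fun i => ((p ^ (s₂ - 1) : ℕ) : ℤ) * u i) (fun i hi => by simp [hu i hi]) (by
          simp only [mul_smul]
          rw [← Finset.smul_sum, hs, natCast_zsmul, smul_smul, pow_sub_one_mul (by omega), hexp']) i
        rw [← pow_sub_one_mul (show s₂ ≠ 0 by omega), Nat.cast_mul] at this
        exact Int.dvd_of_mul_dvd_mul_left (by exact_mod_cast (pow_pos hp.pos _).ne') this
      choose v hv using hpu
      have hvE : ∑ i, v i • f i ∈ H := mem_closure_image_iff.2
        ⟨v, fun i hi => by simpa [hp.ne_zero, hu i hi] using hv i, rfl⟩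
      obtain ⟨z, hz⟩ := hsoc' (y - ∑ i, v i • f i) (by
        rw [smul_sub, ← hs, Finset.smul_sum, ← Finset.sum_sub_distrib]
        refine Finset.sum_eq_zero fun i _ => ?_
        rw [hv i, mul_smul, natCast_zsmul, sub_self])
      refine ⟨π z, ?_⟩
      rw [pow_zero, one_smul, ← map_nsmul, ← hz, map_sub, (hπ _).2 hvE, sub_zero])
  have hF' : ∀ u : {x // x ∈ U} → ℤ, (∀ i ∉ F, u i = 0) → ∑ i, u i • f i ∈ H →
      ∀ i, ((p ^ s₁ : ℕ) : ℤ) ∣ u i := fun u hu hs => by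
    refine hF u hu ?_
    rw [← (hπ _).2 hs, map_sum]
    exact Finset.sum_congr rfl fun i _ => (map_zsmul π _ _).symm
  have hk1 : ¬ ((p ^ s₁ : ℕ) : ℤ) ∣ 1 := fun h => by
    have := Nat.dvd_one.1 (Int.natCast_dvd_natCast.1 (by exact_mod_cast h))
    rw [Nat.pow_eq_one] at this
    rcases this with h | h
    · exact hp.one_lt.ne' h
    · omega
  have hsingle : ∀ i ∈ F, ∀ z : ℤ, z • f i ∈ H → ((p ^ s₁ : ℕ) : ℤ) ∣ z := fun i hi z hz => by
    have := hF' (Pi.single i z) (fun j hj => ?_) (by rwa [sum_single_smul]) i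
    · simpa using this
    · have hji : j ≠ i := by rintro rfl; exact hj hi
      simp [hji]
  have hEF : ∀ i ∈ F, i ∉ E := fun i hiF hiE =>
    hk1 (hsingle i hiF 1 (by
      rw [one_smul]; exact AddSubgroup.subset_closure (Set.mem_image_of_mem f hiE)))
  -- Without this, E ∪ F would be independent only modulo H.
  have hFk : ∀ o ∈ F, p ^ s₁ • f o = 0 := by
    intro o hoF
    obtain ⟨m, hm, hmd, a, ha, ha0, ha1, has, hone, hcard, hsupp⟩ :=
      hL.exists_order_mod hf hEind (hEF o hoF)
    have hm1 : m ∣ p ^ s₁ := by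
      obtain ⟨u, hu, hs⟩ := mem_closure_image_iff.1 (hkE (f o))
      have := hmd (Pi.single o ((p ^ s₁ : ℕ) : ℤ) - u) (fun i hi => ?_) ?_
      · refine Int.natCast_dvd_natCast.1 ?_
        simpa [hu o (hEF o hoF)] using this
      · rw [Set.mem_insert_iff, not_or] at hi
        simp [hi.1, hu i hi.2]
      · rw [sum_sub_smul, sum_single_smul, hs, natCast_zsmul, sub_self]
    have hm2 : p ^ s₁ ∣ m := by
      refine Int.natCast_dvd_natCast.1 (hsingle o hoF m ?_)
      rw [natCast_zsmul, ← has]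
      exact mem_closure_image_iff.2 ⟨a, ha, rfl⟩
    obtain rfl : m = p ^ s₁ := Nat.dvd_antisymm hm1 hm2
    refine smul_eq_zero_of_coord hL hf hp hdvd hne h2 hexp' hn hE ha ha0 ha1 has ?_ hone hcard hsupp
    refine Int.natCast_dvd_natCast.1 (hsingle o hoF _ ?_)
    rw [natCast_zsmul, addOrderOf_nsmul_eq_zero]
    exact zero_mem _
  have hB : IndepOn f (E ∪ F) := by
    intro u hu hs
    let uF : {x // x ∈ U} → ℤ := fun i => if i ∈ F then u i else 0
    have hsuppE : ∀ i ∉ E, (u - uF) i = 0 := fun i hi => by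
      by_cases hiF : i ∈ F
      · simp [uF, hiF]
      · simp [uF, hiF, hu i (by simp [hi, hiF])]
    have huF := hF' uF (fun i hi => by simp [uF, hi]) (by
      have : ∑ i, (u - uF) i • f i ∈ H := mem_closure_image_iff.2 ⟨_, hsuppE, rfl⟩
      rw [sum_sub_smul, hs, zero_sub] at this
      exact neg_mem_iff.1 this)
    have hsF : ∑ i, uF i • f i = 0 := by
      refine Finset.sum_eq_zero fun i _ => ?_
      by_cases hi : i ∈ F
      · obtain ⟨k, hk⟩ := huF i
        rw [hk, mul_comm, mul_smul, natCast_zsmul, hFk i hi, smul_zero]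
      · simp [uF, hi]
    have huE := hEind _ hsuppE (by rw [sum_sub_smul, hs, hsF, sub_zero])
    intro i
    by_cases hi : i ∈ F
    · have h3 := huF i
      simp only [uF, hi, if_true] at h3
      exact (Int.natCast_dvd_natCast.2 (addOrderOf_dvd_of_nsmul_eq_zero (hFk i hi))).trans h3
    · simpa [uF, hi] using huE i
  have hBspan : ∀ y : G, y ∈ AddSubgroup.closure (f '' (E ∪ F)) := by
    intro y
    have h3 := hkF (π y)
    rw [pow_zero, one_smul, mem_closure_image_iff] at h3
    obtain ⟨u, hu, hs⟩ := h3
    have h4 : y - ∑ i, u i • f i ∈ H := by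
      rw [← hπ, map_sub, map_sum, ← hs, sub_eq_zero]
      exact Finset.sum_congr rfl fun i _ => (map_zsmul π _ _).symm
    have h5 : ∑ i, u i • f i ∈ AddSubgroup.closure (f '' F) := mem_closure_image_iff.2 ⟨u, hu, rfl⟩
    have h6 := add_mem
      (AddSubgroup.closure_mono (Set.image_mono (f := f) (Set.subset_union_left (t := F))) h4)
      (AddSubgroup.closure_mono (Set.image_mono (f := f) (Set.subset_union_right (s := E))) h5)
    simpa using h6
  have hb2 : 2 < addOrderOf (f b) := by
    rw [hordE b hbE]
    have := Nat.le_self_pow (show s₂ ≠ 0 by omega) p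
    have := hp.two_le
    omega
  refine hU.false_of_indepOn hG hc (fun i => i.2) hB (Or.inl hbE) hb2 fun g hg => ?_
  by_cases hgB : (⟨g, hg⟩ : {x // x ∈ U}) ∈ E ∪ F
  · exact Or.inr ⟨_, hgB, AddSubgroup.mem_zmultiples g⟩
  obtain ⟨m, hm, hmd, a, ha, ha0, ha1, has, hone, hcard, hsupp⟩ := hL.exists_order_mod hf hB hgB
  -- E ∪ F generates G, so g itself is a combination of the basis.
  have hm1 : m = 1 := by
    obtain ⟨u, hu, hs⟩ := mem_closure_image_iff.1 (hBspan g)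
    have := hmd (Pi.single ⟨g, hg⟩ 1 - u) (fun i hi => ?_) ?_
    · refine Nat.dvd_one.1 (Int.natCast_dvd_natCast.1 ?_)
      simpa [hu _ hgB] using this
    · rw [Set.mem_insert_iff, not_or] at hi
      simp [hi.1, hu i hi.2]
    · rw [sum_sub_smul, sum_single_smul, hs, one_smul, sub_self]
  subst hm1
  exact two_smul_eq_zero_or_mem_zmultiples ha has hsupp

end PrimePower

/-! ### Exponent pq. -/

section TwoPrimes

variable {G : Type*} [AddCommGroup G]

/-- Otherwise U splits into terms killed by p and terms killed by q. Both parts have sum zero, so by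
minimality one is empty, but the terms generate a group of exponent pq. -/
theorem IsMinZeroSum.exists_addOrderOf_eq_mul [Finite G] {U : Multiset G} (hU : IsMinZeroSum U)
    (hc : U.card = davenport G) {p q : ℕ} (hp : p.Prime) (hq : q.Prime) (hpq : p ≠ q)
    (hexp : AddMonoid.exponent G = p * q) : ∃ b ∈ U, addOrderOf b = p * q := by
  classical
  have hgen := hU.closure_eq_top hc
  by_contra! hno
  have hcop : Nat.Coprime p q := (Nat.coprime_primes hp hq).2 hpq
  have hor : ∀ g ∈ U, p • g = 0 ∨ q • g = 0 := fun g hg => by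
    have hd : addOrderOf g ∣ p * q := hexp ▸ AddMonoid.addOrder_dvd_exponent g
    obtain ⟨x, y, hx, hy, hxy⟩ := (Nat.dvd_mul).1 hd
    rw [← addOrderOf_dvd_iff_nsmul_eq_zero, ← addOrderOf_dvd_iff_nsmul_eq_zero]
    rcases (Nat.dvd_prime hp).1 hx with rfl | rfl
    · right; rw [← hxy, one_mul]; exact hy
    rcases (Nat.dvd_prime hq).1 hy with rfl | rfl
    · left; rw [← hxy, mul_one]
    · exact absurd hxy.symm (hno g hg)
  set S := U.filter (p • · = 0) with hS
  set R := U.filter (¬ p • · = 0) with hR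
  have hSR : S + R = U := Multiset.filter_add_not _ _
  have hsum : S.sum + R.sum = 0 := by rw [← Multiset.sum_add, hSR, hU.2.1]
  have hSs : p • S.sum = 0 := by
    rw [← Multiset.map_id' S, ← Multiset.sum_map_nsmul]
    refine Multiset.sum_eq_zero fun x hx => ?_
    obtain ⟨g, hg, rfl⟩ := Multiset.mem_map.1 hx
    exact (Multiset.mem_filter.1 hg).2
  have hRs : q • R.sum = 0 := by
    rw [← Multiset.map_id' R, ← Multiset.sum_map_nsmul]
    refine Multiset.sum_eq_zero fun x hx => ?_
    obtain ⟨g, hg, rfl⟩ := Multiset.mem_map.1 hx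
    obtain ⟨hgU, hgp⟩ := Multiset.mem_filter.1 hg
    exact (hor g hgU).resolve_left hgp
  have hS0 : S.sum = 0 := by
    refine AddMonoid.addOrderOf_eq_one_iff.1 (Nat.eq_one_of_dvd_coprimes hcop
      (addOrderOf_dvd_of_nsmul_eq_zero hSs) (addOrderOf_dvd_of_nsmul_eq_zero ?_))
    rw [eq_neg_of_add_eq_zero_left hsum, smul_neg, hRs, neg_zero]
  obtain ⟨g, hg, hgp⟩ := exists_smul_ne_zero_of_closure hgen (n := p) (by
    rw [hexp]
    intro h
    have := Nat.le_of_dvd hp.pos h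
    nlinarith [hq.two_le, hp.pos])
  obtain ⟨k, hk, hkq⟩ := exists_smul_ne_zero_of_closure hgen (n := q) (by
    rw [hexp]
    intro h
    have := Nat.le_of_dvd hq.pos h
    nlinarith [hp.two_le, hq.pos])
  have hkS : k ∈ S := Multiset.mem_filter.2 ⟨hk, (hor k hk).resolve_right hkq⟩
  have hSU := hU.2.2 S (Multiset.filter_le _ _) (fun h => by simp [h] at hkS) hS0
  rw [← hSU] at hg
  exact hgp (Multiset.mem_filter.1 hg).2

theorem indepOn_insert {ι : Type*} [Fintype ι] {f : ι → G} {E : Set ι} (hE : IndepOn f E) {o : ι}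
    {m : ℕ}
    (hdvd : ∀ u : ι → ℤ, (∀ i ∉ insert o E, u i = 0) → ∑ i, u i • f i = 0 → (m : ℤ) ∣ u o)
    (hm : m • f o = 0) : IndepOn f (insert o E) := by
  classical
  intro u hu hs
  obtain ⟨k, hk⟩ := hdvd u hu hs
  have h0 : u o • f o = 0 := by rw [hk, mul_comm, mul_smul, natCast_zsmul, hm, smul_zero]
  have h1 := hE (u - Pi.single o (u o) : ι → ℤ) (fun i hi => ?_) (by
    rw [sum_sub_smul, sum_single_smul, hs, h0, sub_zero])
  · intro i
    rcases eq_or_ne i o with rfl | hio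
    · rwa [addOrderOf_dvd_iff_zsmul_eq_zero]
    · simpa [hio] using h1 i
  · rcases eq_or_ne i o with rfl | hio
    · simp
    · simp [hio, hu i (by simp [hi, hio])]

theorem order_mod_dvd {ι : Type*} [Fintype ι] {f : ι → G} {E : Set ι} {o : ι} (hoE : o ∉ E) {m : ℕ}
    (hdvd : ∀ u : ι → ℤ, (∀ i ∉ insert o E, u i = 0) → ∑ i, u i • f i = 0 → (m : ℤ) ∣ u o)
    {n : ℕ} (hn : n • f o ∈ AddSubgroup.closure (f '' E)) : m ∣ n := by
  classical
  obtain ⟨u, hu, hs⟩ := mem_closure_image_iff.1 hn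
  have := hdvd (Pi.single o (n : ℤ) - u : ι → ℤ) (fun i hi => ?_) ?_
  · exact Int.natCast_dvd_natCast.1 (by simpa [hu o hoE] using this)
  · rw [Set.mem_insert_iff, not_or] at hi
    simp [hi.1, hu i hi.2]
  · rw [sum_sub_smul, sum_single_smul, hs, natCast_zsmul, sub_self]

/-- Any maximal independent set E of terms works. For g outside E, mg ≠ 0 and 2 is invertible on G,
so mg is a multiple of one e and m ≡ 1; among the divisors of pq only m = 1 remains. -/
theorem IsMinZeroSum.false_of_two_primes [Finite G] (hG : ¬ IsAddCyclic G) {U : Multiset G}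
    (hU : IsMinZeroSum U) (hc : U.card = davenport G) {ℓ : ℕ} [Fact ℓ.Prime]
    (hL : LengthCongr (symmSupp U) ℓ) {p q : ℕ} (hp : p.Prime) (hq : q.Prime) (hpq : p ≠ q)
    (hexp : AddMonoid.exponent G = p * q) (hp2 : p ≠ 2) (hq2 : q ≠ 2)
    (h3 : (p + q : ZMod ℓ) ≠ 3) : False := by
  classical
  have := Fintype.ofFinite G
  let f : {x // x ∈ U} → G := Subtype.val
  have hf : ∀ i, f i ∈ symmSupp U := fun i => mem_symmSupp i.2
  obtain ⟨b, hbU, hb⟩ := hU.exists_addOrderOf_eq_mul hc hp hq hpq hexp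
  have hF : (p * q : ZMod ℓ) = 2 := by
    have := hL.addOrderOf_eq_two (mem_symmSupp hbU)
    rw [hb] at this
    exact_mod_cast this
  -- As pq ≡ 2, if one prime is ≡ 1 then the other is ≡ 2 and p + q ≡ 3.
  have hp1 : (p : ZMod ℓ) ≠ 1 := fun h => h3 (by rw [h, one_mul] at hF; rw [h, hF]; norm_num)
  have hq1 : (q : ZMod ℓ) ≠ 1 := fun h => h3 (by rw [h, mul_one] at hF; rw [h, hF]; norm_num)
  have hord : ∀ x : G, addOrderOf x ∣ p * q := fun x => hexp ▸ AddMonoid.addOrder_dvd_exponent x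
  have hcop2 : Nat.Coprime 2 (p * q) := Nat.Coprime.mul_right
    ((Nat.coprime_primes Nat.prime_two hp).2 hp2.symm)
    ((Nat.coprime_primes Nat.prime_two hq).2 hq2.symm)
  have htwo : ∀ x : G, 2 • x = 0 → x = 0 := fun x hx =>
    AddMonoid.addOrderOf_eq_one_iff.1 (Nat.eq_one_of_dvd_coprimes hcop2
      (addOrderOf_dvd_of_nsmul_eq_zero hx) (hord x))
  obtain ⟨E, hE⟩ := (Set.toFinite {E : Set {x // x ∈ U} | IndepOn f E}).exists_maximal
    ⟨∅, fun u hu _ i => by simp [hu i (Set.notMem_empty i)]⟩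
  have hkey : ∀ g ∈ U, ∃ e ∈ E, g ∈ AddSubgroup.zmultiples (f e) := by
    intro g hg
    by_cases hgE : (⟨g, hg⟩ : {x // x ∈ U}) ∈ E
    · exact ⟨_, hgE, AddSubgroup.mem_zmultiples g⟩
    obtain ⟨m, hm, hmd, a, ha, ha0, ha1, has, hone, hcard, hsupp⟩ :=
      hL.exists_order_mod hf hE.prop hgE
    have hm0 : m • g ≠ 0 := fun h0 =>
      hgE (hE.le_of_ge (indepOn_insert hE.prop hmd h0) (Set.subset_insert _ E) (Set.mem_insert _ E))
    have hsupp' := hsupp.resolve_left fun h => hm0 (htwo _ (by rw [smul_smul]; exact h))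
    rcases sum_smul_of_card_le_one (f := f) hsupp' with ⟨-, h0⟩ | ⟨e, he, hc1, h1⟩
    · exact absurd (has.symm.trans h0) hm0
    refine ⟨e, not_imp_comm.1 (ha e) he, ?_⟩
    rw [hc1] at hcard
    have hmF : (m : ZMod ℓ) = 1 := by push_cast at hcard; linear_combination hcard
    have hmpq : m ∣ p * q := order_mod_dvd hgE hmd (by
      rw [show (p * q) • f ⟨g, hg⟩ = 0 from addOrderOf_dvd_iff_nsmul_eq_zero.1 (hord g)]
      exact zero_mem _)
    obtain ⟨x, y, hx, hy, hxy⟩ := (Nat.dvd_mul).1 hmpq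
    have hm1 : m = 1 := by
      rcases (Nat.dvd_prime hp).1 hx with rfl | rfl <;> rcases (Nat.dvd_prime hq).1 hy with rfl | rfl
      · exact hxy.symm
      · rw [← hxy, one_mul] at hmF; exact absurd hmF hq1
      · rw [← hxy, mul_one] at hmF; exact absurd hmF hp1
      · exact absurd (addOrderOf_dvd_iff_nsmul_eq_zero.1 (hxy ▸ hord g)) hm0
    rw [hm1, one_smul, h1] at has
    exact ⟨a e, has⟩
  obtain ⟨e, heE, -⟩ := hkey b hbU
  refine hU.false_of_indepOn hG hc (fun i => i.2) hE.prop heE ?_ fun g hg => Or.inr (hkey g hg)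
  have h0 : f e ≠ 0 := fun h => hL.zero_notMem (h ▸ hf e)
  have h1 : addOrderOf (f e) ≠ 1 := fun h => h0 (AddMonoid.addOrderOf_eq_one_iff.1 h)
  have h2 : addOrderOf (f e) ≠ 2 := fun h => h0 (htwo _ (by rw [← h, addOrderOf_nsmul_eq_zero]))
  have := addOrderOf_pos (f e)
  omega

theorem indepOn_singleton {ι : Type*} [Fintype ι] (f : ι → G) (b : ι) : IndepOn f {b} := by
  intro u hu hs i
  by_cases hi : i = b
  · subst hi
    rwa [Finset.sum_eq_single i (fun j _ hj => by simp [hu j hj]) (by simp),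
      ← addOrderOf_dvd_iff_zsmul_eq_zero] at hs
  · rw [hu i hi]
    exact dvd_zero _

/-- 2G lies in the p-torsion, a line over 𝔽_p spanned by 2b. -/
theorem two_smul_mem_zmultiples_of_pRank_eq_one {p : ℕ} (hp : p.Prime)
    (hexp : ∀ x : G, (2 * p) • x = 0) (hrank : pRank p G = 1) {b : G} (hb : 2 • b ≠ 0) (g : G) :
    2 • g ∈ AddSubgroup.zmultiples b := by
  have := Fact.mk hp
  let _ : Module (ZMod p) (AddSubgroup.torsionBy G (p : ℤ)) := AddSubgroup.torsionBy.zmodModule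
  have hmem : ∀ x : G, 2 • x ∈ AddSubgroup.torsionBy G (p : ℤ) := fun x => by
    have := hexp x
    rw [mul_comm, mul_smul] at this
    simpa [AddSubgroup.torsionBy] using this
  obtain ⟨c, hc⟩ := (finrank_eq_one_iff_of_nonzero' (⟨2 • b, hmem b⟩ :
    AddSubgroup.torsionBy G (p : ℤ)) (fun h => hb (congrArg Subtype.val h))).1 hrank ⟨2 • g, hmem g⟩
  rw [← ZMod.natCast_zmod_val c, Nat.cast_smul_eq_nsmul] at hc
  have h1 : c.val • 2 • b = 2 • g := congrArg Subtype.val hc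
  rw [← h1]
  exact nsmul_mem (nsmul_mem (AddSubgroup.mem_zmultiples b) _) _

/-- A single term b of order 2p serves as the independent family, since 2G ⊆ ⟨b⟩. -/
theorem IsMinZeroSum.false_of_pRank_eq_one [Finite G] (hG : ¬ IsAddCyclic G) {U : Multiset G}
    (hU : IsMinZeroSum U) (hc : U.card = davenport G) {ℓ : ℕ} [Fact ℓ.Prime]
    (hL : LengthCongr (symmSupp U) ℓ) {p : ℕ} (hp : p.Prime) (hp2 : p ≠ 2)
    (hexp : AddMonoid.exponent G = p * 2) (hrank : pRank p G = 1) : False := by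
  classical
  have := Fintype.ofFinite G
  let f : {x // x ∈ U} → G := Subtype.val
  have hf : ∀ i, f i ∈ symmSupp U := fun i => mem_symmSupp i.2
  obtain ⟨b, hbU, hb⟩ := hU.exists_addOrderOf_eq_mul hc hp Nat.prime_two hp2 hexp
  have hb2 : 2 < addOrderOf b := by have := hp.two_le; omega
  have hbn : 2 • b ≠ 0 := fun h => by
    have := Nat.le_of_dvd (by norm_num) (addOrderOf_dvd_of_nsmul_eq_zero h)
    omega
  have hmul := two_smul_mem_zmultiples_of_pRank_eq_one hp
    (fun x => by rw [mul_comm, ← hexp, AddMonoid.exponent_nsmul_eq_zero]) hrank hbn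
  refine hU.false_of_indepOn hG hc (fun i => i.2) (indepOn_singleton f ⟨b, hbU⟩)
    (Set.mem_singleton _) hb2 fun g hg => ?_
  by_cases hgb : (⟨g, hg⟩ : {x // x ∈ U}) ∈ ({⟨b, hbU⟩} : Set {x // x ∈ U})
  · exact Or.inr ⟨_, hgb, AddSubgroup.mem_zmultiples g⟩
  obtain ⟨m, hm, hmd, a, ha, ha0, ha1, has, hone, hcard, hsupp⟩ :=
    hL.exists_order_mod hf (indepOn_singleton f ⟨b, hbU⟩) hgb
  have hm2 : m ∣ 2 := order_mod_dvd hgb hmd (by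
    rw [Set.image_singleton, ← AddSubgroup.zmultiples_eq_closure]
    exact hmul g)
  rcases (Nat.dvd_prime Nat.prime_two).1 hm2 with rfl | rfl
  · exact two_smul_eq_zero_or_mem_zmultiples ha has hsupp
  · have hle : (Finset.univ.filter (a · ≠ 0)).card ≤ 1 := by
      have hall : ∀ i ∈ Finset.univ.filter (a · ≠ 0), i = ⟨b, hbU⟩ := fun i hi =>
        not_imp_comm.1 (ha i) (Finset.mem_filter.1 hi).2
      exact Finset.card_le_one.2 fun i hi j hj => (hall i hi).trans (hall j hj).symm
    rcases sum_smul_of_card_le_one (f := f) hle with ⟨-, h0⟩ | ⟨e, he, hc1, h1⟩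
    · exact Or.inl (has.symm.trans h0)
    -- Order 2 modulo ⟨b⟩ with one non-zero coordinate would give 2 + 1 ≡ 2.
    · rw [hc1] at hcard
      push_cast at hcard
      exact absurd (by linear_combination hcard) (one_ne_zero (α := ZMod ℓ))

end TwoPrimes

/-! ### Exponent 2p and ℓ = 2: relations modulo involutions. -/

section TwoMulPrime

variable {G : Type*} [AddCommGroup G] {ι : Type*} [Fintype ι]

/-- The elements `f i`, `i ∈ E`, have order `2 * p`, and the `2 • f i` are linearly independent
over `ℤ/p`. -/
structure OddIndepOn (p : ℕ) (f : ι → G) (E : Set ι) : Prop where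
  order : ∀ i ∈ E, addOrderOf (f i) = 2 * p
  indep : ∀ u : ι → ℤ, (∀ i ∉ E, u i = 0) → 2 • ∑ i, u i • f i = 0 → ∀ i, (p : ℤ) ∣ u i

variable {p : ℕ} {f : ι → G} {E : Set ι} {o : ι}

theorem eq_mul_of_dvd_of_abs_lt {p z : ℤ} (hd : p ∣ z) (hz : |z| < 2 * p) :
    z = 0 ∨ z = p ∨ z = -p := by
  obtain ⟨k, rfl⟩ := hd
  have hp : 0 < p := by have := abs_nonneg (p * k); omega
  rw [abs_lt] at hz
  have h1 : -2 < k := by nlinarith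
  have h2 : k < 2 := by nlinarith
  have : k = 0 ∨ k = 1 ∨ k = -1 := by omega
  rcases this with rfl | rfl | rfl <;> simp

/-- All u i are divisible by p, so only x and y can carry ±p. There ±p f x and ±p f y are the
involutions p f x and p f y, which cancel only if they coincide. -/
theorem OddIndepOn.eq_zero (hE : OddIndepOn p f E) {u v : ι → ℤ} (huv : Conformal u v)
    (hv : ∀ i ∉ insert o E, v i = 0) {x y : ι} (hx : x ∈ E) (hy : y ∈ E)
    (hxy : x = y ∨ p • f x ≠ p • f y) (hlt : ∀ i ∈ E, i ≠ x → i ≠ y → |v i| < p)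
    (hvx : |v x| < 2 * p) (hvy : |v y| < 2 * p) (h0 : u o = 0) (hs : ∑ i, u i • f i = 0) :
    u = 0 := by
  classical
  have hu : ∀ i ∉ E, u i = 0 := fun i hi => by
    rcases eq_or_ne i o with rfl | hio
    · exact h0
    · have h1 := huv i
      rw [hv i (by simp [hi, hio])] at h1
      omega
  have hle : ∀ i, |u i| ≤ |v i| := fun i => by
    have h1 := huv i
    rw [abs_le]
    rcases le_total 0 (v i) with h | h
    · rw [abs_of_nonneg h]; omega
    · rw [abs_of_nonpos h]; omega
  have hd := hE.indep u hu (by rw [hs, smul_zero])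
  have hother : ∀ i, i ≠ x → i ≠ y → u i = 0 := fun i hix hiy => by
    by_cases hi : i ∈ E
    · exact Int.eq_zero_of_abs_lt_dvd (hd i) ((hle i).trans_lt (hlt i hi hix hiy))
    · exact hu i hi
  have hzero : ∀ i ∈ E, u i • f i = 0 → |v i| < 2 * p → u i = 0 := fun i hi hz hvi => by
    rw [← addOrderOf_dvd_iff_zsmul_eq_zero, hE.order i hi] at hz
    exact Int.eq_zero_of_abs_lt_dvd hz (by push_cast; exact (hle i).trans_lt hvi)
  rcases eq_or_ne x y with rfl | hne
  · rw [Finset.sum_eq_single x (fun i _ hi => by rw [hother i hi hi, zero_smul]) (by simp)] at hs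
    funext i
    by_cases hi : i = x
    · rw [hi]; exact hzero x hx hs hvx
    · exact hother i hi hi
  · rw [Finset.sum_eq_add x y hne (fun i _ hi => by rw [hother i hi.1 hi.2, zero_smul]) (by simp)
      (by simp)] at hs
    have hneg : ∀ i ∈ E, (-(p : ℤ)) • f i = p • f i := fun i hi => by
      rw [neg_smul, natCast_zsmul, neg_eq_iff_add_eq_zero, ← two_nsmul, smul_smul, ← hE.order i hi,
        addOrderOf_nsmul_eq_zero]
    have hxz := eq_mul_of_dvd_of_abs_lt (hd x) ((hle x).trans_lt hvx)
    have hyz := eq_mul_of_dvd_of_abs_lt (hd y) ((hle y).trans_lt hvy)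
    have hx' : u x = 0 ∨ u x • f x = p • f x := by
      rcases hxz with h | h | h
      · exact Or.inl h
      · right; rw [h, natCast_zsmul]
      · right; rw [h, hneg x hx]
    have hy' : u y = 0 ∨ u y • f y = p • f y := by
      rcases hyz with h | h | h
      · exact Or.inl h
      · right; rw [h, natCast_zsmul]
      · right; rw [h, hneg y hy]
    have hux : u x = 0 := by
      rcases hx' with h | hxp
      · exact h
      rcases hy' with h | hyp
      · exact hzero x hx (by rw [h, zero_smul, add_zero] at hs; exact hs) hvx
      · rw [hxp, hyp] at hs
        refine absurd ?_ (hxy.resolve_left hne)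
        rw [eq_neg_of_add_eq_zero_left hs, ← natCast_zsmul (f y), ← neg_smul, hneg y hy, natCast_zsmul]
    have huy : u y = 0 := hzero y hy (by rw [hux, zero_smul, zero_add] at hs; exact hs) hvy
    funext i
    by_cases hix : i = x
    · rw [hix, hux]; rfl
    by_cases hiy : i = y
    · rw [hiy, huy]; rfl
    · exact hother i hix hiy

theorem OddIndepOn.isMinZeroSum_of_neg_one (hE : OddIndepOn p f E) {v : ι → ℤ}
    (hv : ∀ i ∉ insert o E, v i = 0) {x : ι} (hx : x ∈ E) (hlt : ∀ i ∈ E, i ≠ x → |v i| < p)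
    (hvx : |v x| < 2 * p) (ho : v o = -1) (hs : ∑ i, v i • f i = 0) :
    IsMinZeroSum (signedSeq f v) := by
  refine isMinZeroSum_signedSeq (fun h => ?_) hs fun u huv hus => ?_
  · rw [h, Pi.zero_apply] at ho
    omega
  have hlt' : ∀ i ∈ E, i ≠ x → i ≠ x → |v i| < p := fun i hi h _ => hlt i hi h
  have h1 := huv o
  have h2 : u o = 0 ∨ u o = -1 := by omega
  rcases h2 with h | h
  · exact Or.inl (hE.eq_zero huv hv hx hx (Or.inl rfl) hlt' hvx hvx h hus)
  · right
    have h3 := hE.eq_zero huv.sub hv hx hx (Or.inl rfl) hlt' hvx hvx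
      (by rw [Pi.sub_apply, ho, h]; ring) (by rw [sum_sub_smul, hs, hus, sub_zero])
    exact (sub_eq_zero.1 h3).symm

/-- A subrelation u with coordinate -1 at o would agree with c modulo p, hence equal c on E by size;
this would give ∑ c i f i = f o. -/
theorem OddIndepOn.isMinZeroSum_of_neg_two [DecidableEq ι] (hE : OddIndepOn p f E) (hoE : o ∉ E)
    {c : ι → ℤ} (hc : ∀ i ∉ E, c i = 0) {x y : ι} (hx : x ∈ E) (hy : y ∈ E)
    (hxy : x = y ∨ p • f x ≠ p • f y) (hcp : ∀ i ∈ E, |c i| < p)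
    (hlt : ∀ i ∈ E, i ≠ x → i ≠ y → |2 * c i| < p) (hs : 2 • ∑ i, c i • f i = 2 • f o)
    (hne : ∑ i, c i • f i ≠ f o) :
    IsMinZeroSum (signedSeq f (2 • c - Pi.single o 2)) := by
  have hEo : ∀ i ∈ E, i ≠ o := by rintro i hi rfl; exact hoE hi
  have hv : ∀ i ∉ insert o E, (2 • c - Pi.single o 2 : ι → ℤ) i = 0 := fun i hi => by
    rw [Set.mem_insert_iff, not_or] at hi
    simp [hi.1, hc i hi.2]
  have hvi : ∀ i ∈ E, (2 • c - Pi.single o 2 : ι → ℤ) i = 2 * c i := fun i hi => by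
    simp [hEo i hi]
  have ho : (2 • c - Pi.single o 2 : ι → ℤ) o = -2 := by simp [hc o hoE]
  have hvs : ∑ i, (2 • c - Pi.single o 2 : ι → ℤ) i • f i = 0 := by
    rw [sum_sub_smul, sum_single_smul, sub_eq_zero]
    simp only [Pi.smul_apply, smul_assoc]
    rw [← Finset.smul_sum, hs]
    norm_cast
  have hlt' : ∀ i ∈ E, i ≠ x → i ≠ y → |(2 • c - Pi.single o 2 : ι → ℤ) i| < p :=
    fun i hi hix hiy => by rw [hvi i hi]; exact hlt i hi hix hiy
  have h2p : ∀ i ∈ E, |(2 • c - Pi.single o 2 : ι → ℤ) i| < 2 * p := fun i hi => by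
    rw [hvi i hi, abs_mul, abs_two]
    have := hcp i hi
    omega
  generalize (2 • c - Pi.single o 2 : ι → ℤ) = v at *
  refine isMinZeroSum_signedSeq (fun h => ?_) hvs fun u huv hus => ?_
  · rw [h, Pi.zero_apply] at ho
    omega
  have h1 := huv o
  have h2 : u o = 0 ∨ u o = -1 ∨ u o = -2 := by omega
  rcases h2 with h | h | h
  · exact Or.inl (hE.eq_zero huv hv hx hy hxy hlt' (h2p x hx) (h2p y hy) h hus)
  · exfalso
    have hu : ∀ i ∉ insert o E, u i = 0 := fun i hi => by
      have := huv i; rw [hv i hi] at this; omega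
    have hsum : ∑ i, (u + Pi.single o 1 - c : ι → ℤ) i • f i = f o - ∑ i, c i • f i := by
      rw [sum_sub_smul, sum_add_smul, sum_single_smul, hus, one_smul, zero_add]
    have hsupp : ∀ i ∉ E, (u + Pi.single o 1 - c : ι → ℤ) i = 0 := fun i hi => by
      rcases eq_or_ne i o with rfl | hio
      · simp [h, hc i hi]
      · simp [hio, hc i hi, hu i (by simp [hi, hio])]
    have hd := hE.indep _ hsupp (by rw [hsum, smul_sub, hs, sub_self])
    refine hne (sub_eq_zero.1 ?_).symm
    rw [← hsum]
    refine Finset.sum_eq_zero fun i _ => ?_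
    by_cases hi : i ∈ E
    · rw [Int.eq_zero_of_abs_lt_dvd (hd i) ?_, zero_smul]
      have h3 := huv i
      rw [hvi i hi] at h3
      have h4 := hcp i hi
      rw [abs_lt] at h4 ⊢
      simp only [Pi.add_apply, Pi.sub_apply, Pi.single_eq_of_ne (hEo i hi)]
      omega
    · rw [hsupp i hi, zero_smul]
  · right
    have h3 := hE.eq_zero huv.sub hv hx hy hxy hlt' (h2p x hx) (h2p y hy)
      (by rw [Pi.sub_apply, ho, h]; ring) (by rw [sum_sub_smul, hvs, hus, sub_zero])
    exact (sub_eq_zero.1 h3).symm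

theorem intCast_zmod_two_eq_one {z : ℤ} : ((z : ℤ) : ZMod 2) = 1 ↔ z % 2 = 1 := by
  have := ZMod.intCast_eq_intCast_iff z 1 2
  rw [Int.cast_one] at this
  rw [this, Int.ModEq]
  norm_num

variable {G₀ : Set G}

/-- Shifting the coordinate at x by ±2p = ±ord(f x) links two atoms, so `LengthCongr.flip` yields
its parity. -/
theorem OddIndepOn.odd_of_sum_eq [Finite G] (hE : OddIndepOn p f E) (hL : LengthCongr G₀ 2)
    (hf : ∀ i, f i ∈ G₀) (hoE : o ∉ E) {c : ι → ℤ} (hc : ∀ i ∉ E, c i = 0)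
    (hcp : ∀ i ∈ E, |c i| < p) (hs : ∑ i, c i • f i = f o) {x : ι} (hx : c x ≠ 0) :
    c x % 2 = 1 := by
  classical
  have hxE : x ∈ E := not_imp_comm.1 (hc x) hx
  have hEo : ∀ i ∈ E, i ≠ o := by rintro i hi rfl; exact hoE hi
  have hxp := hcp x hxE
  rw [abs_lt] at hxp
  have key : ∀ d : ℤ, |c x + 2 * d * p| < 2 * p → IsMinZeroSum
      (signedSeq f (c - Pi.single o 1 + Pi.single x (2 * d * p))) := fun d hd => by
    refine hE.isMinZeroSum_of_neg_one (o := o) (fun i hi => ?_) hxE (fun i hi hix => ?_) ?_ ?_ ?_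
    · rw [Set.mem_insert_iff, not_or] at hi
      have hix : i ≠ x := by rintro rfl; exact hi.2 hxE
      simp [hi.1, hc i hi.2, hix]
    · simpa [hix, hEo i hi] using hcp i hi
    · simpa [hEo x hxE] using hd
    · simp [hc o hoE, (hEo x hxE).symm]
    · have h0 : (2 * d * p) • f x = 0 := by
        rw [← addOrderOf_dvd_iff_zsmul_eq_zero, hE.order x hxE]
        exact ⟨d, by push_cast; ring⟩
      rw [sum_add_smul, sum_sub_smul, sum_single_smul, sum_single_smul, hs, h0]
      simp
  rcases lt_or_gt_of_ne hx with hneg | hpos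
  · have := hL.flip hf (i := x) (by simp [hEo x hxE, hE.order x hxE]) (fun j hj => by simp [hj])
      (by simp [hEo x hxE]; omega) (by simp [hEo x hxE, hE.order x hxE]; omega)
      (key 1 (by rw [abs_lt]; omega)) (key 0 (by rw [abs_lt]; omega))
    rw [intCast_zmod_two_eq_one] at this
    simp [hEo x hxE] at this
    omega
  · have := hL.flip hf (i := x) (by simp [hEo x hxE, hE.order x hxE]; ring)
      (fun j hj => by simp [hj])
      (by simp [hEo x hxE]; omega) (by simp [hEo x hxE, hE.order x hxE]; omega)
      (key 0 (by rw [abs_lt]; omega)) (key (-1) (by rw [abs_lt]; omega))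
    rw [intCast_zmod_two_eq_one] at this
    simp [hEo x hxE] at this
    omega

/-- If both fail, doubling c and doubling c with c x - p at x give two atoms that are flips of each
other at x, and the even number 2 c x would be odd. -/
theorem OddIndepOn.sum_eq_or [Finite G] (hE : OddIndepOn p f E) (hL : LengthCongr G₀ 2)
    (hf : ∀ i, f i ∈ G₀) (hoE : o ∉ E) {c : ι → ℤ} (hc : ∀ i ∉ E, c i = 0)
    (hcp : ∀ i ∈ E, |c i| < p) (hs : 2 • ∑ i, c i • f i = 2 • f o) {x y : ι} (hx : x ∈ E)
    (hy : y ∈ E) (hxy : x = y ∨ p • f x ≠ p • f y)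
    (hlt : ∀ i ∈ E, i ≠ x → i ≠ y → |2 * c i| < p) (hx0 : 0 < c x) :
    ∑ i, c i • f i = f o ∨ ∑ i, c i • f i - p • f x = f o := by
  classical
  have hEo : ∀ i ∈ E, i ≠ o := by rintro i hi rfl; exact hoE hi
  have hxp := hcp x hx
  rw [abs_lt] at hxp
  by_contra! hcon
  have h2p : 2 • p • f x = 0 := by
    rw [smul_smul, ← hE.order x hx, addOrderOf_nsmul_eq_zero]
  have hs' : ∑ i, (c - Pi.single x (p : ℤ) : ι → ℤ) i • f i = ∑ i, c i • f i - p • f x := by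
    rw [sum_sub_smul, sum_single_smul, natCast_zsmul]
  have h1 := hE.isMinZeroSum_of_neg_two hoE hc hx hy hxy hcp hlt hs hcon.1
  have h2 := hE.isMinZeroSum_of_neg_two (c := c - Pi.single x (p : ℤ)) hoE (fun i hi => ?_) hx hy
    hxy (fun i hi => ?_) (fun i hi hix hiy => ?_) ?_ (by rw [hs']; exact hcon.2)
  · have := hL.flip hf (i := x) (by simp [hEo x hx, hE.order x hx]; ring) (fun j hj => by simp [hj])
      (by simp [hEo x hx]; omega) (by simp [hEo x hx, hE.order x hx]; omega) h1 h2
    rw [intCast_zmod_two_eq_one] at this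
    simp [hEo x hx] at this
  · have hix : i ≠ x := by rintro rfl; exact hi hx
    simp [hc i hi, hix]
  · rcases eq_or_ne i x with rfl | hix
    · simp only [Pi.sub_apply, Pi.single_eq_same]
      rw [abs_lt]
      omega
    · simpa [hix] using hcp i hi
  · simpa [hix] using hlt i hi hix hiy
  · rw [hs', smul_sub, h2p, sub_zero, hs]

/-- With two support coordinates x and y, `OddIndepOn.sum_eq_or` produces two exact representations
of f o, one with c x and one with c x - p at x. Both numbers would be odd, but p is odd. -/
theorem OddIndepOn.mem_zmultiples [Finite G] (hp2 : p % 2 = 1) (hE : OddIndepOn p f E)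
    (hL : LengthCongr G₀ 2) (hf : ∀ i, f i ∈ G₀) (hoE : o ∉ E) {c : ι → ℤ}
    (hc : ∀ i ∉ E, c i = 0) (hc0 : ∀ i, 0 ≤ c i) (hcp : ∀ i, 2 * c i < p)
    (hs : 2 • ∑ i, c i • f i = 2 • f o) :
    2 • f o = 0 ∨ ∃ e ∈ E, f o ∈ AddSubgroup.zmultiples (f e) := by
  classical
  have hcE : ∀ i, c i ≠ 0 → i ∈ E := fun i => not_imp_comm.1 (hc i)
  have hcp1 : ∀ i ∈ E, |c i| < p := fun i _ => by
    have := hc0 i; have := hcp i; rw [abs_lt]; omega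
  have hcp2 : ∀ i ∈ E, |2 * c i| < p := fun i _ => by
    have := hc0 i; have := hcp i; rw [abs_lt]; omega
  have hodd : ∀ d : ι → ℤ, (∀ i, d i = c i ∨ c i ≠ 0 ∧ d i = c i - p) → ∑ i, d i • f i = f o →
      ∀ i, d i ≠ 0 → d i % 2 = 1 := fun d hd hds i hi => by
    refine hE.odd_of_sum_eq hL hf hoE (fun j hj => ?_) (fun j hj => ?_) hds hi
    · have := hd j
      have := hc j hj
      omega
    · have := hd j; have := hc0 j; have := hcp j
      rw [abs_lt]; omega
  have hfirst : ∀ x, c x ≠ 0 → ∑ i, c i • f i = f o ∨ ∑ i, c i • f i - p • f x = f o :=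
    fun x hx => hE.sum_eq_or hL hf hoE hc hcp1 hs (hcE x hx) (hcE x hx) (Or.inl rfl)
      (fun i hi _ _ => hcp2 i hi) (lt_of_le_of_ne (hc0 x) hx.symm)
  have hflip : ∀ x, ∑ i, (c - Pi.single x (p : ℤ) : ι → ℤ) i • f i = ∑ i, c i • f i - p • f x :=
    fun x => by rw [sum_sub_smul, sum_single_smul, natCast_zsmul]
  have hflipd : ∀ x, c x ≠ 0 → ∀ i, (c - Pi.single x (p : ℤ) : ι → ℤ) i = c i ∨
      c i ≠ 0 ∧ (c - Pi.single x (p : ℤ) : ι → ℤ) i = c i - p := fun x hx i => by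
    rcases eq_or_ne i x with rfl | hix
    · right; simp [hx]
    · left; simp [hix]
  by_cases h2 : ∃ x y, x ≠ y ∧ c x ≠ 0 ∧ c y ≠ 0
  · exfalso
    obtain ⟨x, y, hxy, hx, hy⟩ := h2
    have hx0 := lt_of_le_of_ne (hc0 x) hx.symm
    by_cases hrep : ∑ i, c i • f i = f o
    · have hcx := hodd c (fun i => Or.inl rfl) hrep x hx
      have hpx : ∑ i, c i • f i - p • f x ≠ f o := fun h => by
        have h3 := hodd _ (hflipd x hx) (by rw [hflip, h]) x
        have := hcp x
        simp only [Pi.sub_apply, Pi.single_eq_same] at h3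
        omega
      have h2x : 2 • p • f x = 0 := by
        rw [smul_smul, ← hE.order x (hcE x hx), addOrderOf_nsmul_eq_zero]
      -- If the involutions coincide, subtracting both leaves the sum unchanged; otherwise
      -- `OddIndepOn.sum_eq_or` is applied at y after subtracting p at x.
      by_cases hpxy : p • f x = p • f y
      · have hd := hodd (c - Pi.single x (p : ℤ) - Pi.single y (p : ℤ)) (fun i => ?_) ?_ x
        · have := hcp x
          simp only [Pi.sub_apply, Pi.single_eq_same, Pi.single_eq_of_ne hxy] at hd
          omega
        · rcases eq_or_ne i x with rfl | hix
          · right; simp [hx, hxy]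
          rcases eq_or_ne i y with rfl | hiy
          · right; simp [hy, hix]
          · left; simp [hix, hiy]
        · rw [sum_sub_smul, hflip, sum_single_smul, natCast_zsmul, ← hpxy, hrep, sub_sub,
            ← two_nsmul, h2x, sub_zero]
      · have h3 := hE.sum_eq_or hL hf hoE (c := c - Pi.single x (p : ℤ)) (x := y) (y := x)
          (fun i hi => ?_) (fun i hi => ?_) (by rw [hflip, smul_sub, h2x, sub_zero, hs])
          (hcE y hy) (hcE x hx) (Or.inr (Ne.symm hpxy)) (fun i hi hiy hix => ?_)
          (by simpa [hxy.symm] using lt_of_le_of_ne (hc0 y) hy.symm)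
        · rw [hflip] at h3
          have h4 := h3.resolve_left hpx
          have hd := hodd (c - Pi.single x (p : ℤ) - Pi.single y (p : ℤ)) (fun i => ?_)
            (by rw [sum_sub_smul, hflip, sum_single_smul, natCast_zsmul, h4]) x
          · have := hcp x
            simp only [Pi.sub_apply, Pi.single_eq_same, Pi.single_eq_of_ne hxy] at hd
            omega
          · rcases eq_or_ne i x with rfl | hix
            · right; simp [hx, hxy]
            rcases eq_or_ne i y with rfl | hiy
            · right; simp [hy, hix]
            · left; simp [hix, hiy]
        · have := hflipd x hx i
          have := hc i hi
          omega
        · have := hflipd x hx i; have := hc0 i; have := hcp i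
          rw [abs_lt]; omega
        · simpa [hix] using hcp2 i hi
    · have h3 := (hfirst x hx).resolve_left hrep
      have h4 := (hfirst y hy).resolve_left hrep
      have h5 := hodd _ (hflipd x hx) (by rw [hflip, h3]) x
      have h6 := hodd _ (hflipd y hy) (by rw [hflip, h4]) x
      have := hcp x
      simp only [Pi.sub_apply, Pi.single_eq_same, Pi.single_eq_of_ne hxy] at h5 h6
      omega
  · push Not at h2
    by_cases h1 : ∃ x, c x ≠ 0
    · obtain ⟨x, hx⟩ := h1
      have hsx : ∑ i, c i • f i = c x • f x :=
        Finset.sum_eq_single x (fun i _ hi => by rw [h2 x i hi.symm hx, zero_smul]) (by simp)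
      right
      refine ⟨x, hcE x hx, ?_⟩
      rcases hfirst x hx with h | h
      · exact ⟨c x, by rw [← h, hsx]⟩
      · exact ⟨c x - p, by rw [← h, hsx]; simp [sub_smul]⟩
    · push Not at h1
      left
      rw [← hs, Finset.sum_eq_zero fun i _ => by rw [h1 i, zero_smul], smul_zero]

end TwoMulPrime

/-! ### Exponent 2p and ℓ = 2: conclusion. -/

section TwoMulPrime

variable {G : Type*} [AddCommGroup G]

theorem exists_small_coord {ι : Type*} [Fintype ι] {p : ℕ} (hp2 : p % 2 = 1) {w : ι → G}
    (hw : ∀ i, p • w i = 0) {E : Set ι} {u : ι → ℤ} (hu : ∀ i ∉ E, u i = 0) :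
    ∃ c : ι → ℤ, (∀ i ∉ E, c i = 0) ∧ (∀ i, 2 * |c i| < p) ∧
      ∑ i, c i • w i = ∑ i, u i • w i := by
  have key : ∀ z : ℤ, ∃ r : ℤ, 2 * |r| < p ∧ (p : ℤ) ∣ z - r ∧ (z = 0 → r = 0) := fun z => by
    have h0 := Int.emod_nonneg z (show (p : ℤ) ≠ 0 by omega)
    have h1 := Int.emod_lt_of_pos z (show (0 : ℤ) < p by omega)
    by_cases h : 2 * (z % p) < p
    · refine ⟨z % p, by rw [abs_of_nonneg h0]; exact h, Int.dvd_self_sub_emod, ?_⟩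
      rintro rfl; simp
    · refine ⟨z % p - p, by rw [abs_of_neg (by omega)]; omega, ?_, ?_⟩
      · rw [show z - (z % p - p) = z - z % p + p by ring]
        exact dvd_add Int.dvd_self_sub_emod dvd_rfl
      · rintro rfl
        simp at h
        omega
  choose r hr1 hr2 hr3 using key
  refine ⟨fun i => r (u i), fun i hi => hr3 _ (hu i hi), fun i => hr1 _, ?_⟩
  refine Finset.sum_congr rfl fun i _ => ?_
  obtain ⟨k, hk⟩ := hr2 (u i)
  rw [eq_comm, ← sub_eq_zero, ← sub_smul, hk, mul_comm, mul_smul, natCast_zsmul, hw, smul_zero]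

/-- Replacing f i by -f i where c i < 0 reduces to non-negative coordinates, since `G₀` is
symmetric. -/
theorem OddIndepOn.exists_mem_zmultiples [Finite G] {ι : Type*} [Fintype ι] {p : ℕ}
    (hp2 : p % 2 = 1) {f : ι → G} {E : Set ι} {o : ι} (hE : OddIndepOn p f E) {G₀ : Set G}
    (hL : LengthCongr G₀ 2) (hf : ∀ i, f i ∈ G₀) (hoE : o ∉ E) {c : ι → ℤ}
    (hc : ∀ i ∉ E, c i = 0) (hcp : ∀ i, 2 * |c i| < p) (hs : 2 • ∑ i, c i • f i = 2 • f o) :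
    2 • f o = 0 ∨ ∃ e ∈ E, f o ∈ AddSubgroup.zmultiples (f e) := by
  classical
  let f' : ι → G := fun i => if c i < 0 then -f i else f i
  have hf' : ∀ i, f' i = f i ∨ f' i = -f i := fun i => by
    by_cases h : c i < 0 <;> simp [f', h]
  have hfo : f' o = f o := by simp [f', hc o hoE]
  have hE' : OddIndepOn p f' E := by
    refine ⟨fun i hi => ?_, fun u hu hus i => ?_⟩
    · rcases hf' i with h | h
      · rw [h, hE.order i hi]
      · rw [h, addOrderOf_neg, hE.order i hi]
    · have h1 := hE.indep (fun i => if c i < 0 then -u i else u i)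
        (fun i hi => by simp [hu i hi]) (by
          rw [← hus]
          congr 1
          refine Finset.sum_congr rfl fun i _ => ?_
          by_cases h : c i < 0 <;> simp [f', h]) i
      by_cases h : c i < 0
      · simpa [h] using h1
      · simpa [h] using h1
  have hG₀ : ∀ i, f' i ∈ G₀ := fun i => by
    rcases hf' i with h | h
    · rw [h]; exact hf i
    · rw [h]; exact hL.neg_mem _ (hf i)
  have h := hE'.mem_zmultiples hp2 hL hG₀ hoE (c := fun i => |c i|) (fun i hi => by simp [hc i hi])
    (fun i => abs_nonneg _) hcp (by
      rw [hfo, ← hs]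
      congr 1
      refine Finset.sum_congr rfl fun i _ => ?_
      by_cases h : c i < 0
      · simp [f', h, abs_of_neg h]
      · simp [f', h, abs_of_nonneg (not_lt.1 h)])
  rw [hfo] at h
  refine h.imp id ?_
  rintro ⟨e, he, hmem⟩
  refine ⟨e, he, ?_⟩
  rcases hf' e with h | h
  · rwa [h] at hmem
  · rwa [h, AddSubgroup.zmultiples_neg] at hmem

theorem IsMinZeroSum.false_of_two_mul_prime [Finite G] (hG : ¬ IsAddCyclic G) {U : Multiset G}
    (hU : IsMinZeroSum U) (hc : U.card = davenport G) (hL : LengthCongr (symmSupp U) 2) {p : ℕ}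
    (hp : p.Prime) (hp2 : p ≠ 2) (hexp : AddMonoid.exponent G = p * 2) : False := by
  classical
  have := Fintype.ofFinite G
  have hodd : p % 2 = 1 := hp.eq_two_or_odd.resolve_left hp2
  let f : {x // x ∈ U} → G := Subtype.val
  have hf : ∀ i, f i ∈ symmSupp U := fun i => mem_symmSupp i.2
  have hexp' : ∀ x : G, p • 2 • x = 0 := fun x => by
    rw [smul_smul, ← hexp, AddMonoid.exponent_nsmul_eq_zero]
  obtain ⟨E, hE, hspan⟩ := exists_basis_of_smul_eq_zero hp (w := fun i => 2 • f i)
    fun i => hexp' (f i)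
  have hsum : ∀ u : {x // x ∈ U} → ℤ, ∑ i, u i • 2 • f i = 2 • ∑ i, u i • f i := fun u => by
    rw [Finset.smul_sum]
    exact Finset.sum_congr rfl fun i _ => smul_comm _ _ _
  have hEodd : OddIndepOn p f E := by
    refine ⟨fun i hi => ?_, fun u hu hs => hE u hu (by rw [hsum, hs])⟩
    have h2 : 2 • f i ≠ 0 := fun h => by
      have h1 := hE (Pi.single i 1) (fun j hj => ?_) (by
        rw [sum_single_smul (fun i => 2 • f i), one_smul]; exact h) i
      · rw [Pi.single_eq_same] at h1
        have := Int.le_of_dvd one_pos h1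
        have := hp.two_le
        omega
      · have hji : j ≠ i := by rintro rfl; exact hj hi
        simp [hji]
    have hd : addOrderOf (f i) ∣ p * 2 := hexp ▸ AddMonoid.addOrder_dvd_exponent _
    obtain ⟨x, y, hx, hy, hxy⟩ := (Nat.dvd_mul).1 hd
    rcases (Nat.dvd_prime hp).1 hx with rfl | rfl
    · refine absurd (addOrderOf_dvd_iff_nsmul_eq_zero.1 ?_) h2
      rw [← hxy, one_mul]; exact hy
    rcases (Nat.dvd_prime Nat.prime_two).1 hy with rfl | rfl
    -- Orders are even when ℓ = 2, so order p is impossible.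
    · have h3 := hL.addOrderOf_eq_two (hf i)
      rw [← hxy, mul_one, show (2 : ZMod 2) = 0 from rfl, ZMod.natCast_eq_zero_iff] at h3
      omega
    · rw [← hxy, mul_comm]
  have hkey : ∀ g ∈ U, 2 • g = 0 ∨ ∃ e ∈ E, g ∈ AddSubgroup.zmultiples (f e) := by
    intro g hg
    by_cases hgE : (⟨g, hg⟩ : {x // x ∈ U}) ∈ E
    · exact Or.inr ⟨_, hgE, AddSubgroup.mem_zmultiples g⟩
    obtain ⟨u, hu, hs⟩ := mem_closure_image_iff.1 (hspan ⟨g, hg⟩)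
    obtain ⟨c, hcE, hcp, hcs⟩ := exists_small_coord hodd (fun i => hexp' (f i)) hu
    exact hEodd.exists_mem_zmultiples hodd hL hf hgE hcE hcp (by rw [← hsum, hcs, hs])
  obtain ⟨b₀, hb₀U, hb₀⟩ := hU.exists_addOrderOf_eq_mul hc hp Nat.prime_two hp2 hexp
  obtain ⟨b, hbE⟩ : E.Nonempty := by
    rcases hkey b₀ hb₀U with h | ⟨e, he, -⟩
    · have := Nat.le_of_dvd (by norm_num) (addOrderOf_dvd_of_nsmul_eq_zero h)
      have := hp.two_le
      omega
    · exact ⟨e, he⟩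
  -- The complement is spanned by the doubled terms, because the f i need not be independent: their
  -- involutions may coincide.
  refine hU.false_of_splitting hG hc b.2 (b := f b) ?_
    (AddSubgroup.closure ((fun i => 2 • f i) '' (E \ {b}))) (fun x hx hxb => ?_) fun g hg => ?_
  · rw [hEodd.order b hbE]
    have := hp.two_le
    omega
  · obtain ⟨u, hu, hs⟩ := mem_closure_image_iff.1 hx
    obtain ⟨k, rfl⟩ := AddSubgroup.mem_zmultiples_iff.1 hxb
    have hd := hEodd.indep (2 • u - Pi.single b k : {x // x ∈ U} → ℤ) (fun i hi => ?_) ?_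
    · rw [← hs]
      refine Finset.sum_eq_zero fun i _ => ?_
      by_cases hib : i = b
      · rw [hu i (by simp [hib]), zero_smul]
      have h1 : (p : ℤ) ∣ 2 * u i := by simpa [hib] using hd i
      obtain ⟨l, hl⟩ := (Nat.prime_iff_prime_int.1 hp).dvd_or_dvd h1 |>.resolve_left fun h => by
        have := Int.le_of_dvd (by norm_num) h
        have := hp.two_le
        omega
      rw [hl, mul_comm, mul_smul, natCast_zsmul, hexp', smul_zero]
    · have hib : i ≠ b := by rintro rfl; exact hi hbE
      simp [hib, hu i (by simp [hi])]
    · rw [sum_sub_smul, sum_single_smul, ← hs, hsum]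
      simp only [Pi.smul_apply, smul_assoc]
      rw [← Finset.smul_sum, sub_self, smul_zero]
  · rcases hkey g hg with h2 | ⟨e, he, hge⟩
    · right; rw [h2]; exact zero_mem _
    by_cases heb : e = b
    · left; rwa [← heb]
    · right
      obtain ⟨k, rfl⟩ := AddSubgroup.mem_zmultiples_iff.1 hge
      rw [smul_comm]
      exact zsmul_mem (AddSubgroup.subset_closure (Set.mem_image_of_mem (fun i => 2 • f i)
        (show e ∈ E \ {b} from ⟨he, heb⟩))) _

end TwoMulPrime

/-! ### The four families. -/

section Families

variable {G : Type*} [AddCommGroup G]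

theorem dvd_sub_of_cast_eq {ℓ n m : ℕ} (hm : m ≤ n) (h : (n : ZMod ℓ) = m) : ℓ ∣ n - m := by
  rw [← ZMod.natCast_eq_zero_iff, Nat.cast_sub hm, h, sub_self]

theorem ZMod.exists_eq_pow_smul {p s : ℕ} (hp : p.Prime) (hs : 1 ≤ s) {x : ZMod (p ^ s)}
    (hx : p • x = 0) : ∃ z : ZMod (p ^ s), x = p ^ (s - 1) • z := by
  have : NeZero (p ^ s) := ⟨(pow_pos hp.pos s).ne'⟩
  rw [← ZMod.natCast_zmod_val x, nsmul_eq_mul, ← Nat.cast_mul, ZMod.natCast_eq_zero_iff] at hx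
  nth_rewrite 1 [← mul_pow_sub_one (show s ≠ 0 by omega)] at hx
  obtain ⟨k, hk⟩ := Nat.dvd_of_mul_dvd_mul_left hp.pos hx
  exact ⟨k, by rw [← ZMod.natCast_zmod_val x, hk, nsmul_eq_mul, Nat.cast_mul]⟩

theorem pi_exists_eq_pow_smul {p s r : ℕ} (hp : p.Prime) (hs : 1 ≤ s)
    {x : Fin r → ZMod (p ^ s)} (hx : p • x = 0) : ∃ z : Fin r → ZMod (p ^ s), x = p ^ (s - 1) • z := by
  choose z hz using fun i => ZMod.exists_eq_pow_smul hp hs (congrFun hx i)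
  exact ⟨z, funext hz⟩

theorem pi_pow_smul_eq_zero {p s t r : ℕ} (hst : s ≤ t) (x : Fin r → ZMod (p ^ s)) :
    p ^ t • x = 0 := by
  funext i
  rw [Pi.smul_apply, nsmul_eq_mul, (ZMod.natCast_eq_zero_iff _ _).2 (pow_dvd_pow p hst), zero_mul]
  rfl

/-- Terms generate G, so in a p-group one of them has order exp(G). Then ℓ divides both exp(G) - 2
and D(G) - 2. -/
theorem FamilyA.false [Finite G] [Nontrivial G] (h : FamilyA G) {U : Multiset G}
    (hU : IsMinZeroSum U) (hc : U.card = davenport G) {ℓ : ℕ} [Fact ℓ.Prime]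
    (hL : LengthCongr (symmSupp U) ℓ) : False := by
  obtain ⟨p, hp, hpG, hgcd⟩ := h
  have := Fact.mk hp
  obtain ⟨k, hk⟩ := IsPGroup.iff_card.1 hpG
  have hdvd : AddMonoid.exponent G ∣ p ^ k := by
    rw [← hk, Nat.card_congr Multiplicative.toAdd]
    exact AddGroup.exponent_dvd_nat_card
  obtain ⟨s, -, hs⟩ := (Nat.dvd_prime_pow hp).1 hdvd
  have hs0 : s ≠ 0 := by
    rintro rfl
    rw [pow_zero, AddMonoid.exp_eq_one_iff] at hs
    exact not_subsingleton G hs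
  obtain ⟨t, rfl⟩ := Nat.exists_eq_succ_of_ne_zero hs0
  obtain ⟨g, hg, hgt⟩ := exists_smul_ne_zero_of_closure (hU.closure_eq_top hc) (n := p ^ t) (by
    rw [hs, Nat.pow_dvd_pow_iff_le_right hp.one_lt]
    omega)
  have hord : addOrderOf g = AddMonoid.exponent G := by
    rw [hs]
    exact addOrderOf_eq_prime_pow hgt (hs ▸ AddMonoid.exponent_nsmul_eq_zero g)
  have h1 := hL.addOrderOf_eq_two (mem_symmSupp hg)
  have h2 := hL.card_eq_two ⟨hU, fun _ => mem_symmSupp⟩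
  rw [hord] at h1
  rw [hc] at h2
  have hexp2 : 2 ≤ AddMonoid.exponent G := by
    rw [hs]
    exact hp.two_le.trans (Nat.le_self_pow (by omega) p)
  have := Nat.dvd_gcd (dvd_sub_of_cast_eq hexp2 (by exact_mod_cast h1))
    (dvd_sub_of_cast_eq two_le_davenport (by exact_mod_cast h2))
  rw [hgcd] at this
  exact (Fact.out : ℓ.Prime).one_lt.ne' (Nat.dvd_one.1 this)

theorem FamilyB.false [Finite G] (hG : ¬ IsAddCyclic G) (h : FamilyB G) {U : Multiset G}
    (hU : IsMinZeroSum U) (hc : U.card = davenport G) {ℓ : ℕ} [Fact ℓ.Prime]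
    (hL : LengthCongr (symmSupp U) ℓ) : False := by
  obtain ⟨p, r₁, r₂, s₁, s₂, hp, -, hr₂, h1, h2, hdvd, ⟨e⟩, hne⟩ := h
  have hle : s₁ ≤ s₂ := Nat.le_of_dvd h2 hdvd
  have hexp : AddMonoid.exponent G = p ^ s₂ := by
    refine Nat.dvd_antisymm (AddMonoid.exponent_dvd_of_forall_nsmul_eq_zero fun g => ?_) ?_
    · refine e.injective ?_
      rw [map_nsmul, map_zero]
      exact Prod.ext (pi_pow_smul_eq_zero hle _) (pi_pow_smul_eq_zero le_rfl _)
    · have h3 := congrArg e (AddMonoid.exponent_nsmul_eq_zero (e.symm (0, fun _ => 1)))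
      rw [map_nsmul, map_zero, e.apply_symm_apply] at h3
      have h4 := congrFun (congrArg Prod.snd h3) ⟨0, hr₂⟩
      rw [← ZMod.natCast_eq_zero_iff]
      simpa using h4
  refine hU.false_of_primePower hG hc hL hp h1 h2 hdvd hexp (hexp ▸ hne) (fun y hy => ?_)
    fun y hy => ?_
  · have h3 := congrArg e hy
    rw [map_nsmul, map_nsmul, map_zero] at h3
    obtain ⟨z, hz⟩ := pi_exists_eq_pow_smul hp h2 (congrArg Prod.snd h3)
    refine ⟨e.symm (0, z), e.injective ?_⟩
    rw [map_nsmul, map_nsmul, e.apply_symm_apply]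
    refine Prod.ext ?_ hz
    rw [Prod.smul_fst, Prod.smul_fst, smul_zero]
    exact pi_pow_smul_eq_zero le_rfl _
  · have h3 := congrArg e hy
    rw [map_nsmul, map_zero] at h3
    obtain ⟨z₁, hz₁⟩ := pi_exists_eq_pow_smul hp h1 (congrArg Prod.fst h3)
    obtain ⟨z₂, hz₂⟩ := pi_exists_eq_pow_smul hp h2 (congrArg Prod.snd h3)
    refine ⟨e.symm (z₁, p ^ (s₂ - s₁) • z₂), e.injective ?_⟩
    rw [map_nsmul, e.apply_symm_apply]
    refine Prod.ext hz₁ ?_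
    rw [Prod.smul_snd, smul_smul, ← pow_add, show s₁ - 1 + (s₂ - s₁) = s₂ - 1 by omega]
    exact hz₂

theorem FamilyC.false [Finite G] [Nontrivial G] (hG : ¬ IsAddCyclic G) (h : FamilyC G)
    {U : Multiset G} (hU : IsMinZeroSum U) (hc : U.card = davenport G) {ℓ : ℕ} [hℓ : Fact ℓ.Prime]
    (hL : LengthCongr (symmSupp U) ℓ) : False := by
  obtain ⟨p, q, hp, hq, hpq, hexp, h⟩ := h
  obtain ⟨b, hbU, hb⟩ := hU.exists_addOrderOf_eq_mul hc hp hq hpq hexp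
  have h1 := hL.addOrderOf_eq_two (mem_symmSupp hbU)
  rw [hb] at h1
  have hpq2 : 2 ≤ p * q := by nlinarith [hp.two_le, hq.two_le]
  have hd := dvd_sub_of_cast_eq hpq2 (by exact_mod_cast h1)
  have hℓ1 : ¬ ℓ ∣ 1 := fun h => hℓ.out.one_lt.ne' (Nat.dvd_one.1 h)
  rcases h with h | h | ⟨rfl, m, hm⟩ | ⟨rfl, hr⟩
  · have h2 := hL.card_eq_two ⟨hU, fun _ => mem_symmSupp⟩
    rw [hc] at h2
    exact hℓ1 (h ▸ Nat.dvd_gcd hd (dvd_sub_of_cast_eq two_le_davenport (by exact_mod_cast h2)))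
  -- For p = 2 the gcd is q - 1, and it equals 1 only if q = 2 = p.
  · have hp2 : p ≠ 2 := by
      rintro rfl
      rw [show 2 * q - 2 = (2 + q - 3) * 2 by omega, Nat.gcd_mul_right_left] at h
      omega
    have hq2 : q ≠ 2 := by
      rintro rfl
      rw [show p * 2 - 2 = (p + 2 - 3) * 2 by omega, Nat.gcd_mul_right_left] at h
      omega
    refine hU.false_of_two_primes hG hc hL hp hq hpq hexp hp2 hq2 fun h3 => hℓ1 ?_
    refine h ▸ Nat.dvd_gcd hd (dvd_sub_of_cast_eq ?_ (by exact_mod_cast h3))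
    have := hp.two_le
    have := hq.two_le
    omega
  -- ℓ divides 2p - 2, which is a power of 2.
  · obtain rfl : ℓ = 2 := by
      rw [show p * 2 - 2 = 2 ^ (m + 1) by rw [pow_succ]; omega] at hd
      exact (Nat.prime_dvd_prime_iff_eq hℓ.out Nat.prime_two).1 (hℓ.out.dvd_of_dvd_pow hd)
    exact hU.false_of_two_mul_prime hG hc hL hp hpq hexp
  · exact hU.false_of_pRank_eq_one hG hc hL hp hpq hexp hr

/-- The exponents are odd primes, 4 and 9 (squares of primes, s₁ = 1 and s₂ = 2), and 6 and 10,
where p - 1 is a power of 2. -/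
theorem FamilyD.false [Finite G] [Nontrivial G] (hG : ¬ IsAddCyclic G) (h : FamilyD G)
    {U : Multiset G} (hU : IsMinZeroSum U) (hc : U.card = davenport G) {ℓ : ℕ} [hℓ : Fact ℓ.Prime]
    (hL : LengthCongr (symmSupp U) ℓ) : False := by
  have hprime : ∀ p : ℕ, p.Prime → p ≠ 2 → AddMonoid.exponent G ≠ p := fun p hp hp2 hexp => by
    refine hU.false_of_primePower hG hc hL hp le_rfl le_rfl dvd_rfl (by rw [hexp, pow_one])
      (by rwa [pow_one]) (fun y _ => ⟨0, ?_⟩) fun y _ => ⟨y, by simp⟩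
    rw [pow_one, ← hexp, AddMonoid.exponent_nsmul_eq_zero, smul_zero]
  have hsquare : ∀ p : ℕ, p.Prime → p ^ 2 ≠ 2 → AddMonoid.exponent G ≠ p ^ 2 :=
    fun p hp hp2 hexp => hU.false_of_primePower hG hc hL hp le_rfl one_le_two (one_dvd 2) hexp hp2
      (fun y _ => ⟨y, rfl⟩) fun y _ => ⟨y, by simp⟩
  have hdouble : ∀ p m : ℕ, p.Prime → p ≠ 2 → p - 1 = 2 ^ m → AddMonoid.exponent G ≠ p * 2 :=
    fun p m hp hp2 hm hexp => FamilyC.false hG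
      ⟨p, 2, hp, Nat.prime_two, hp2, hexp, Or.inr (Or.inr (Or.inl ⟨rfl, m, hm⟩))⟩ hU hc hL
  obtain ⟨⟨h3, h11⟩, h8⟩ := h
  rw [Set.mem_singleton_iff] at h8
  have h3' := hprime 3 (by norm_num) (by norm_num)
  have h5 := hprime 5 (by norm_num) (by norm_num)
  have h7 := hprime 7 (by norm_num) (by norm_num)
  have h11' := hprime 11 (by norm_num) (by norm_num)
  have h4 := hsquare 2 (by norm_num) (by norm_num)
  have h9 := hsquare 3 (by norm_num) (by norm_num)
  have h6 := hdouble 3 1 (by norm_num) (by norm_num) (by norm_num)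
  have h10 := hdouble 5 2 (by norm_num) (by norm_num) (by norm_num)
  omega

end Families

/-! ### From the congruence to the set of distances. -/

section LengthDifferences

variable {G : Type*} [AddCommGroup G]

/-- The group of differences of lengths of factorizations of zero-sum sequences over `G₀`. -/
def lengthDifferences (G₀ : Set G) : AddSubgroup ℤ where
  carrier := {z | ∃ X Y : Multiset (Multiset G), (∀ A ∈ X, IsMinZeroSumOver G₀ A) ∧
    (∀ A ∈ Y, IsMinZeroSumOver G₀ A) ∧ X.sum = Y.sum ∧ z = X.card - Y.card}
  zero_mem' := ⟨0, 0, by simp⟩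
  add_mem' := by
    rintro _ _ ⟨X, Y, hX, hY, hs, rfl⟩ ⟨X', Y', hX', hY', hs', rfl⟩
    refine ⟨X + X', Y + Y', fun A hA => (Multiset.mem_add.1 hA).elim (hX A) (hX' A),
      fun A hA => (Multiset.mem_add.1 hA).elim (hY A) (hY' A), ?_, ?_⟩
    · rw [Multiset.sum_add, Multiset.sum_add, hs, hs']
    · rw [Multiset.card_add, Multiset.card_add]
      push_cast
      ring
  neg_mem' := by
    rintro _ ⟨X, Y, hX, hY, hs, rfl⟩
    exact ⟨Y, X, hY, hX, hs.symm, by ring⟩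

theorem one_mem_lengthDifferences {G₀ : Set G} (hneg : ∀ x ∈ G₀, -x ∈ G₀) (h0 : (0 : G) ∉ G₀)
    (h : ∀ ℓ : ℕ, ℓ.Prime → ¬ LengthCongr G₀ ℓ) : 1 ∈ lengthDifferences G₀ := by
  obtain ⟨d, hd⟩ := Int.subgroup_cyclic (lengthDifferences G₀)
  have hd1 : d.natAbs = 1 := by
    by_contra hne
    -- This covers d = 0, which every prime divides.
    obtain ⟨ℓ, hℓ, hdvd⟩ := Nat.exists_prime_and_dvd hne
    refine h ℓ hℓ ⟨hneg, h0, fun X Y hX hY hs => ?_⟩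
    have hmem : (X.card - Y.card : ℤ) ∈ lengthDifferences G₀ := ⟨X, Y, hX, hY, hs, rfl⟩
    rw [hd, ← AddSubgroup.zmultiples_eq_closure, Int.mem_zmultiples_iff] at hmem
    have h1 := (ZMod.intCast_zmod_eq_zero_iff_dvd _ ℓ).2 ((Int.natCast_dvd.2 hdvd).trans hmem)
    push_cast at h1
    exact sub_eq_zero.1 h1
  rw [hd, ← AddSubgroup.zmultiples_eq_closure, Int.mem_zmultiples_iff]
  exact Int.isUnit_iff_natAbs_eq.2 hd1 |>.dvd

theorem exists_fin_of_multiset {G₀ : Set G} {X : Multiset (Multiset G)}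
    (hX : ∀ A ∈ X, IsMinZeroSumOver G₀ A) {k : ℕ} (hk : X.card = k) :
    ∃ W : Fin k → Multiset G, (∀ i, IsMinZeroSumOver G₀ (W i)) ∧ ∑ i, W i = X.sum := by
  obtain ⟨l, rfl⟩ : ∃ l : List (Multiset G), (l : Multiset (Multiset G)) = X :=
    ⟨X.toList, X.coe_toList⟩
  obtain rfl : l.length = k := by simpa using hk
  refine ⟨l.get, fun i => hX _ (Multiset.mem_coe.2 (List.get_mem l i)), ?_⟩
  rw [Multiset.sum_coe, ← List.sum_ofFn, List.ofFn_get]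

/-- Two factorizations of one sequence whose lengths differ by 1 give adjacent lengths; the shorter
one is non-empty because atoms are. -/
theorem hasUnitStep_and_isLeast {G₀ : Set G} (h : 1 ∈ lengthDifferences G₀) :
    HasUnitStep G₀ ∧ IsLeast (setOfDistances G₀) 1 := by
  obtain ⟨X, Y, hX, hY, hs, hXY⟩ := h
  have hcard : X.card = Y.card + 1 := by omega
  have hY0 : 1 ≤ Y.card := by
    by_contra hlt
    have hY0 : Y = 0 := Multiset.card_eq_zero.1 (by omega)
    obtain ⟨A, rfl⟩ := Multiset.card_eq_one.1 (show X.card = 1 by rw [hcard, hY0]; rfl)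
    rw [hY0, Multiset.sum_zero, Multiset.sum_singleton] at hs
    exact (hX A (Multiset.mem_singleton_self A)).1.1 hs
  obtain ⟨W, hW, hWs⟩ := exists_fin_of_multiset hY rfl
  obtain ⟨V, hV, hVs⟩ := exists_fin_of_multiset hX hcard
  refine ⟨⟨Y.card, hY0, W, V, hW, hV, by rw [hWs, hVs, hs]⟩,
    ⟨Y.sum, ?_, ?_, Y.card, ⟨W, hW, hWs⟩, Y.card + 1, ⟨V, hV, hVs.trans hs⟩, by omega,
      fun c _ hc => by omega, by omega⟩, ?_⟩
  · rw [← hWs, Multiset.sum_sum]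
    exact Finset.sum_eq_zero fun i _ => (hW i).1.2.1
  · intro g hg
    rw [← hWs] at hg
    obtain ⟨i, -, hi⟩ := Multiset.mem_sum.1 hg
    exact (hW i).2 g hi
  · rintro d ⟨A, -, -, a, -, b, -, hab, -, rfl⟩
    omega

end LengthDifferences

end ZeroSum

theorem theorem1p2 {G : Type*} [AddCommGroup G] [Finite G] (hG : ¬ IsAddCyclic G)
    (h : ZeroSum.FamilyA G ∨ ZeroSum.FamilyB G ∨ ZeroSum.FamilyC G ∨ ZeroSum.FamilyD G)
    (U : Multiset G) (hU : ZeroSum.IsMinZeroSum U) (hcard : U.card = ZeroSum.davenport G) :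
    ZeroSum.HasUnitStep (ZeroSum.symmSupp U) ∧
      IsLeast (ZeroSum.setOfDistances (ZeroSum.symmSupp U)) 1 := by
  have : Nontrivial G := by
    by_contra hn
    rw [not_nontrivial_iff_subsingleton] at hn
    exact hG inferInstance
  refine ZeroSum.hasUnitStep_and_isLeast (ZeroSum.one_mem_lengthDifferences ?_ ?_ ?_)
  · rintro x (hx | hx)
    · exact Or.inr (by rwa [neg_neg])
    · exact Or.inl hx
  · rintro (h0 | h0)
    · exact hU.zero_notMem hcard h0
    · exact hU.zero_notMem hcard (neg_zero (G := G) ▸ h0)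
  · intro ℓ hℓ hL
    have := Fact.mk hℓ
    rcases h with h | h | h | h
    · exact h.false hU hcard hL
    · exact h.false hG hU hcard hL
    · exact h.false hG hU hcard hL
    · exact h.false hG hU hcard hL
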